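/- Let $b>a\ge 0$, $w\ge 0$, $h\in\mathbb{R}$ and $0<\beta<1$, and for $x\in\mathbb{R}_+=[0,\infty)$ put $$\phi_0(x)=\frac{x+1}{ax+a+1},\qquad \phi_1(x)=\frac{x+1}{bx+b+1}.$$ These are the error-variance updates of a scalar Kalman filter (one arm of the bandit) under a cheap observation (action $0$) and an expensive observation (action $1$). For $x\in\mathbb{R}_+$ define the two $x$-threshold orbits by $x^{0*}_0=x^{1*}_0=x$ and, for $t\ge 0$ and $\alpha\in\{0,1\}$, $x^{\alpha *}_{t+1}=\phi_{u^{\alpha *}_t}(x^{\alpha *}_t)$, where $u^{0*}_t=1$ if $x^{0*}_t>x$ and $u^{0*}_t=0$ otherwise, and $u^{1*}_t=1$ if $x^{1*}_t\ge x$ and $u^{1*}_t=0$ otherwise. Let $$\lambda^W(x)=w\,\frac{\sum_{t=1}^\infty\beta^t\,(x^{0*}_t-x^{1*}_t)}{\sum_{t=0}^\infty\beta^t\,(u^{1*}_t-u^{0*}_t)}-h .$$ For $\nu\in\mathbb{R}$ (an added cost of the expensive observation), the single-arm problem started at $x\in\mathbb{R}_+$ is to choose actions $u_0,u_1,\dots\in\{0,1\}$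 minimising $\sum_{t\ge0}\beta^t\{(h+\nu)u_t+wx_t\}$, where $x_0=x$ and $x_{t+1}=\phi_{u_t}(x_t)$. Let $V(x|\nu)$ be its optimal cost and let $Q(x,\alpha|\nu)=(h+\nu)\alpha+wx+\beta V(\phi_\alpha(x)|\nu)$ be the optimal cost if the first action must be $\alpha$. Action $\alpha$ is optimal in state $x$ at added cost $\nu$ if $Q(x,\alpha|\nu)\le Q(x,1-\alpha|\nu)$. Then $\lambda^W$ is a continuous and non-decreasing function on $\mathbb{R}_+$. Suppose moreover that (A1) for every $\nu\in\mathbb{R}$ there is a threshold $s\in[0,\infty]$ such that the policy $u_t=1$ if $x_t\ge s$, $u_t=0$ otherwise (never active if $s=\infty$), is optimal for the single-arm problem with added cost $\nu$ from every initial state in $\mathbb{R}_+$. Then the arm is indexable: for all $\nu'\le\nu$ and $x\in\mathbb{R}_+$, if action $1$ is optimal in $x$ at added cost $\nu$ then it is optimal in $x$ at added cost $\nu'$, and if action $0$ is optimal in $x$ at added cost $\nu'$ then it is optimal in $x$ at added cost $\nu$. Furthermore, $\lambda^W(x)$ is the Whittle index of every $x\in\mathbb{R}_+$: for $\nu\in\mathbb{R}$,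 $Q(x,0|\nu)=Q(x,1|\nu)$ if and only if $\nu=\lambda^W(x)$. (In particular, a restless bandit all of whose arms are of this kind and satisfy A1 is indexable.) -/

import Mathlib

open Set

noncomputable section

namespace KalmanBandit

/-- The error-variance maps `φ₀ x = (x + 1) / (a x + a + 1)` (cheap observation, action `false`)
and `φ₁ x = (x + 1) / (b x + b + 1)` (expensive observation, action `true`). -/
def phi (a b : ℝ) (act : Bool) (x : ℝ) : ℝ :=
  if act then (x + 1) / (b * x + b + 1) else (x + 1) / (a * x + a + 1)

/-- The numerical value `0` or `1` of an action. -/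
def actVal (act : Bool) : ℝ := if act then 1 else 0

/-! ### The single-arm problem -/

/-- The error variances `x₀ = x`, `x_{t+1} = φ_{u_t}(x_t)` under the action sequence `u`. -/
def traj (a b : ℝ) (u : ℕ → Bool) (x : ℝ) : ℕ → ℝ
  | 0 => x
  | t + 1 => phi a b (u t) (traj a b u x t)

/-- The discounted cost `∑ β^t ((h + ν) u_t + w x_t)` of the action sequence `u` from `x₀ = x`. -/
def cost (a b w h β ν : ℝ) (u : ℕ → Bool) (x : ℝ) : ℝ :=
  ∑' t : ℕ, β ^ t * ((h + ν) * actVal (u t) + w * traj a b u x t)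

/-- The action sequence `u` is optimal for the single-arm problem with added cost `ν`
started at `x`. -/
def IsOptimal (a b w h β ν : ℝ) (u : ℕ → Bool) (x : ℝ) : Prop :=
  ∀ u' : ℕ → Bool, cost a b w h β ν u x ≤ cost a b w h β ν u' x

/-- The optimal cost of the single-arm problem. -/
def value (a b w h β ν : ℝ) (x : ℝ) : ℝ :=
  ⨅ u : ℕ → Bool, cost a b w h β ν u x

/-- The optimal cost-to-go if the first action must be `act`. -/
def Q (a b w h β ν : ℝ) (x : ℝ) (act : Bool) : ℝ :=
  (h + ν) * actVal act + w * x + β * value a b w h β ν (phi a b act x)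

/-- The error variances when actions are chosen by the stationary policy `π`. -/
def policyTraj (a b : ℝ) (π : ℝ → Bool) (x : ℝ) : ℕ → ℝ
  | 0 => x
  | t + 1 => phi a b (π (policyTraj a b π x t)) (policyTraj a b π x t)

/-- The actions chosen along the orbit of `x` by the stationary policy `π`. -/
def policyActions (a b : ℝ) (π : ℝ → Bool) (x : ℝ) (t : ℕ) : Bool :=
  π (policyTraj a b π x t)

open Classical in
/-- Be active exactly in the states that are at least `s`; `s = ⊤` means never active. -/
def thresholdPolicy (s : EReal) (y : ℝ) : Bool := decide (s ≤ (y : EReal))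

/-- For every added cost `ν` there is a threshold in `[0, ∞]` whose threshold policy is optimal
for the single-arm problem from every initial error variance. -/
def ThresholdOptimal (a b w h β : ℝ) : Prop :=
  ∀ ν : ℝ, ∃ s : EReal, 0 ≤ s ∧ ∀ x : ℝ, 0 ≤ x →
    IsOptimal a b w h β ν (policyActions a b (thresholdPolicy s) x) x

/-- In state `x`, at added cost `ν`, it is optimal for the first action to be `act`. -/
def ActionOptimal (a b w h β ν : ℝ) (x : ℝ) (act : Bool) : Prop :=
  ∀ act' : Bool, Q a b w h β ν x act ≤ Q a b w h β ν x act'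

/-- The arm is indexable: as the added cost of the expensive observation decreases, the set of
states in which the expensive observation is optimal can only grow, and the set of states in which
the cheap observation is optimal can only shrink. -/
def Indexable (a b w h β : ℝ) : Prop :=
  ∀ ν' ν : ℝ, ν' ≤ ν → ∀ x : ℝ, 0 ≤ x →
    (ActionOptimal a b w h β ν x true → ActionOptimal a b w h β ν' x true) ∧
    (ActionOptimal a b w h β ν' x false → ActionOptimal a b w h β ν x false)

/-- `l` is the Whittle index of state `x`: the one and only added cost at which both first
actions are optimal. -/
def IsWhittleIndex (a b w h β : ℝ) (x l : ℝ) : Prop :=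
  ∀ ν : ℝ, Q a b w h β ν x false = Q a b w h β ν x true ↔ ν = l

/-! ### The threshold orbits and the index formula -/

open Classical in
/-- The orbit `x_t^{0*}(x)`: from `x`, be active exactly in the states `y > x`. -/
def orbit0 (a b x : ℝ) : ℕ → ℝ := policyTraj a b (fun y => decide (x < y)) x

open Classical in
/-- The actions `u_t^{0*}(x)`. -/
def action0 (a b x : ℝ) : ℕ → Bool := policyActions a b (fun y => decide (x < y)) x

open Classical in
/-- The orbit `x_t^{1*}(x)`: from `x`, be active exactly in the states `y ≥ x`. -/
def orbit1 (a b x : ℝ) : ℕ → ℝ := policyTraj a b (fun y => decide (x ≤ y)) x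

open Classical in
/-- The actions `u_t^{1*}(x)`. -/
def action1 (a b x : ℝ) : ℕ → Bool := policyActions a b (fun y => decide (x ≤ y)) x

/-- The index
`w (∑_{t ≥ 1} β^t (x_t^{0*} - x_t^{1*})) / (∑_{t ≥ 0} β^t (u_t^{1*} - u_t^{0*})) - h`. -/
def whittleFormula (a b w h β x : ℝ) : ℝ :=
  w * ((∑' t : ℕ, β ^ (t + 1) * (orbit0 a b x (t + 1) - orbit1 a b x (t + 1))) /
      (∑' t : ℕ, β ^ t * (actVal (action1 a b x t) - actVal (action0 a b x t)))) - h

end KalmanBandit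

end

/-! Up to `w` and `h`, the index at `x` is a quotient N / D: N is the discounted difference of the
error variances along the two threshold words of `x`, and D is the discounted difference of their
activations.

Denominator. Monotonicity of the maps and `φ₁ ∘ φ₀ < φ₀ ∘ φ₁` give a comparison principle for
numbers of activations (`count_le_count`). With Abel summation it yields D ≥ 1 - β
(`one_sub_le_usage_sub`). It also shows that activation counts decrease as the threshold rises.

Numerator. In homogeneous coordinates the maps are linear with determinant one. While the words stay
the same between `x` and `y`, the increment of N is (y - x) times ∑ β^t (1/(pq) - 1/(PR)), where p,
q, P, R are denominators of orbits. Convexity of 1/(pq) and Abel summation reduce its sign to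
partial sums of P - p and R - q. These telescope, which leaves an inequality between numerators of
orbits, `action0_fst_le_action1_fst`. To prove it, the threshold is lowered with both words kept
fixed, until an orbit returns to the threshold. There the dynamics on the returning orbit is a
rotation, the words to compare become 10B and 01B with B spelling that orbit backwards
(`return_words`), and a linear computation settles the sign (`lin_swap`).

Continuity. Limits of threshold words are threshold words of the limit state, except that their
choices in that state itself are arbitrary. At the added cost given by the index these choices do
not matter (`cost_eq_of_isThresholdWord`), so compactness of the space of words gives continuity.

Monotonicity. For each T there are only quadratically many level sets on which the words agree up to
time T. The index loses O(β^T) on each and is continuous across them, so the total loss tends to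
zero with T.

Indexability. Under A1 the continuations after either first action follow a common threshold, so the
comparison principle bounds below the slope in ν of Q(x,1|ν) - Q(x,0|ν) by 1 - β. At its unique zero
both threshold words of `x` are optimal, hence equally costly, and this equation determines the
index formula. -/

noncomputable section

namespace KalmanBandit

/-! ### Walks driven by two monotone maps -/

section Walk

variable {α : Type*}

/-- The orbit of `z` when the map `f (u t)` is applied at time `t`. -/
def walk (f : Bool → α → α) (u : ℕ → Bool) (z : α) : ℕ → α
  | 0 => z
  | t + 1 => f (u t) (walk f u z t)

/-- The number of times `s < t` with `u s = true`. -/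
def count (u : ℕ → Bool) (t : ℕ) : ℕ := ∑ s ∈ Finset.range t, (u s).toNat

theorem count_succ (u : ℕ → Bool) (t : ℕ) : count u (t + 1) = count u t + (u t).toNat :=
  Finset.sum_range_succ _ _

theorem walk_congr (f : Bool → α → α) {u u' : ℕ → Bool} (z : α) {T : ℕ}
    (h : ∀ t < T, u t = u' t) : ∀ t ≤ T, walk f u z t = walk f u' z t := by
  intro t
  induction t with
  | zero => intro _; rfl
  | succ t ih =>
    intro ht
    simp only [walk]
    rw [ih (by omega), h t (by omega)]

theorem walk_add (f : Bool → α → α) (u : ℕ → Bool) (z : α) (n t : ℕ) :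
    walk f u z (n + t) = walk f (fun s => u (n + s)) (walk f u z n) t := by
  induction t with
  | zero => rfl
  | succ t ih =>
    rw [← add_assoc]
    simp only [walk, ih]

theorem walk_strictMono [Preorder α] {f : Bool → α → α} (hf : ∀ c, StrictMono (f c))
    (u : ℕ → Bool) (t : ℕ) : StrictMono fun z => walk f u z t := by
  induction t with
  | zero => exact strictMono_id
  | succ t ih => intro x y hxy; exact hf _ (ih hxy)

section Dominate

variable [Preorder α] {f : Bool → α → α} (hf : ∀ c, Monotone (f c))
  (hcomm : ∀ z, f true (f false z) ≤ f false (f true z))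

include hf hcomm

theorem map_iterate_le_iterate_map (k : ℕ) (z : α) :
    f true ((f false)^[k] z) ≤ (f false)^[k] (f true z) := by
  induction k generalizing z with
  | zero => exact le_rfl
  | succ k ih =>
    simp only [Function.iterate_succ, Function.comp]
    exact (ih _).trans ((hf false).iterate k (hcomm z))

theorem iterate_map_le_map_iterate (k : ℕ) (z : α) :
    (f true)^[k] (f false z) ≤ f false ((f true)^[k] z) := by
  induction k generalizing z with
  | zero => exact le_rfl
  | succ k ih =>
    simp only [Function.iterate_succ, Function.comp]
    exact ((hf true).iterate k (hcomm z)).trans (ih _)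

/-- If `u` is active whenever `u'` is active and the map composed along `u` dominates the one
composed along `u'`, then at each time `u` has been active at least as often as `u'`. -/
theorem count_le_count {u u' : ℕ → Bool}
    (h : ∀ t, (∀ z, walk f u' z t ≤ walk f u z t) → u' t = true → u t = true) (t : ℕ) :
    count u' t ≤ count u t := by
  -- Here `k` is the surplus of activations of `u`. Padding `u'` with `k` actions `true` and `u`
  -- with `k` actions `false` equalises lengths and activation counts, and the padded words stay
  -- ordered as maps. At `k = 0` this order is the dominance that `h` requires, so `u'` cannot
  -- overtake.
  suffices H : ∃ k, count u t = count u' t + k ∧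
      ∀ z, (f true)^[k] (walk f u' z t) ≤ (f false)^[k] (walk f u z t) by
    obtain ⟨k, hk, -⟩ := H
    omega
  induction t with
  | zero => exact ⟨0, rfl, fun z => le_rfl⟩
  | succ t ih =>
    obtain ⟨k, hk, hz⟩ := ih
    have e1 := map_iterate_le_iterate_map hf hcomm
    have e2 := iterate_map_le_map_iterate hf hcomm
    simp only [count_succ, walk]
    rcases hu : u t with _ | _ <;> rcases hu' : u' t with _ | _
    · refine ⟨k, by simp [hk], fun z => ?_⟩
      rw [← Function.iterate_succ_apply (f false), Function.iterate_succ_apply' (f false)]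
      exact (e2 _ _).trans (hf _ (hz z))
    · rcases k with _ | k
      · have := h t hz hu'
        simp [hu] at this
      · refine ⟨k, by simp [hk]; omega, fun z => ?_⟩
        rw [← Function.iterate_succ_apply (f false), ← Function.iterate_succ_apply (f true)]
        exact hz z
    · refine ⟨k + 1, by simp [hk]; omega, fun z => ?_⟩
      rw [Function.iterate_succ_apply' (f true)]
      refine (hf true ((e2 _ _).trans (hf _ (hz z)))).trans ?_
      rw [← Function.iterate_succ_apply' (f false)]
      exact e1 _ _
    · refine ⟨k, by simp [hk]; omega, fun z => ?_⟩
      rw [← Function.iterate_succ_apply (f true), Function.iterate_succ_apply' (f true)]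
      exact (hf _ (hz z)).trans (e1 _ _)

end Dominate

end Walk

/-! ### Threshold words of a state that returns to itself -/

/-- The reflection `i ↦ -k - 1 - i` preserves the block of the top `k` residues modulo `n`. It is
the source of the word reversal in `other_word_eq_reverse`. -/
theorem le_emod_reflect {n k : ℤ} (hn : 0 < n) (hk : 0 ≤ k) (hkn : k ≤ n) (i : ℤ) :
    n - k ≤ i % n ↔ n - k ≤ (-k - 1 - i) % n := by
  have h0 := Int.emod_nonneg i hn.ne'
  have h1 := Int.emod_lt_of_pos i hn
  have e := Int.mul_ediv_add_emod i n
  by_cases h : n - k ≤ i % n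
  · have : (-k - 1 - i) % n = 2 * n - k - 1 - i % n := by
      rw [show -k - 1 - i = (2 * n - k - 1 - i % n) + n * (-(i / n) - 2) by linarith,
        Int.add_mul_emod_self_left, Int.emod_eq_of_lt] <;> omega
    omega
  · have : (-k - 1 - i) % n = n - k - 1 - i % n := by
      rw [show -k - 1 - i = (n - k - 1 - i % n) + n * (-(i / n) - 1) by linarith,
        Int.add_mul_emod_self_left, Int.emod_eq_of_lt] <;> omega
    omega

section Return

variable {α : Type*} [LinearOrder α] {f : Bool → α → α} (hf : ∀ c, StrictMono (f c))
  (hlt : ∀ z, f true z < f false z) (hcomm : ∀ z, f true (f false z) < f false (f true z))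
  {x : α} {r : ℕ → Bool} (hr : ∀ t, r t = true ↔ x ≤ walk f r x t)
  {n : ℕ} (hn : 0 < n) (hret : walk f r x n = x)

-- If either inequality failed, the orbit would move strictly to one side of `x` and monotonicity
-- would keep it there, so it could not return.
include hf hlt hr hn hret in
theorem map_true_le_and_le_map_false : f true x ≤ x ∧ x ≤ f false x := by
  have hr0 : r 0 = true := (hr 0).2 le_rfl
  have h1 : walk f r x 1 = f true x := by simp [walk, hr0]
  constructor
  · by_contra! h
    have : ∀ t, x < walk f r x (t + 1) := by
      intro t
      induction t with
      | zero => rw [zero_add, h1]; exact h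
      | succ t ih =>
        rw [walk, (hr _).2 ih.le]
        exact h.trans (hf _ ih)
    obtain ⟨m, rfl⟩ : ∃ m, n = m + 1 := ⟨n - 1, by omega⟩
    exact (this m).ne' hret
  · by_contra! h
    have : ∀ t, walk f r x (t + 1) < x := by
      intro t
      induction t with
      | zero => rw [zero_add, h1]; exact (hlt x).trans h
      | succ t ih =>
        have : r (t + 1) = false := by
          rw [← Bool.not_eq_true, hr]; exact not_le.2 ih
        rw [walk, this]
        exact (hf _ ih).trans h
    obtain ⟨m, rfl⟩ : ∃ m, n = m + 1 := ⟨n - 1, by omega⟩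
    exact (this m).ne hret

-- Steps that obey the threshold `x` are trapped in the interval: for a passive step from `v ≤ x`
-- the lower bound is `f true x ≤ f true (f false x) ≤ f false (f true x) ≤ f false v`, and active
-- steps are symmetric. The last two alternatives are actions against the threshold.
include hf hcomm in
theorem map_mem_Icc (hx1 : f true x ≤ x) (hx0 : x ≤ f false x) {v : α} (h1 : f true x ≤ v)
    (h0 : v ≤ f false x) (c : Bool) : f true x ≤ f c v ∧ f c v ≤ f false x ∨
      (c = true ∧ v < x) ∨ (c = false ∧ x < v) := by
  have hm := fun c => (hf c).monotone
  rcases c with _ | _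
  · rcases le_or_gt v x with h | h
    · exact Or.inl ⟨((hm true hx0).trans (hcomm x).le).trans (hm false h1), hm _ h⟩
    · simp [h]
  · rcases le_or_gt x v with h | h
    · exact Or.inl ⟨hm _ h, (hm true h0).trans ((hcomm x).le.trans (hm false hx1))⟩
    · simp [h]

include hr hret in
theorem walk_add_return (t : ℕ) : walk f r x (t + n) = walk f r x t := by
  induction t with
  | zero => rw [zero_add, hret]; rfl
  | succ t ih =>
    have e : r (t + n) = r t := by rw [Bool.eq_iff_iff, hr, hr, ih]
    rw [Nat.succ_add, walk, walk, ih, e]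

include hr hret in
theorem walk_mod_return (t : ℕ) : walk f r x (t % n) = walk f r x t := by
  conv_rhs => rw [← Nat.mod_add_div t n]
  generalize t / n = m
  induction m with
  | zero => simp
  | succ m ih => rw [Nat.mul_succ, ← add_assoc, walk_add_return hr hret, ih]

variable (hmin : ∀ t, 0 < t → t < n → walk f r x t ≠ x)

-- Two coinciding times would evolve identically up to time `n` and produce an earlier return.
include hr hret hmin in
theorem walk_injOn_return : Set.InjOn (walk f r x) (Finset.range n : Set ℕ) := by
  have key : ∀ i j, i < j → j < n → walk f r x i ≠ walk f r x j := by
    intro i j hij hj h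
    have : ∀ s, walk f r x (i + s) = walk f r x (j + s) := by
      intro s
      induction s with
      | zero => exact h
      | succ s ih =>
        have e : r (i + s) = r (j + s) := by rw [Bool.eq_iff_iff, hr, hr, ih]
        rw [← add_assoc, ← add_assoc, walk, walk, ih, e]
    have h2 := this (n - j)
    rw [show j + (n - j) = n by omega, hret] at h2
    exact hmin _ (by omega) (by omega) h2
  intro i hi j hj h
  simp only [Finset.coe_range, Set.mem_Iio] at hi hj
  rcases lt_trichotomy i j with hij | hij | hij
  · exact (key i j hij hj h).elim
  · exact hij
  · exact (key j i hij hi h.symm).elim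

variable (f x r n) in
/-- The first `n` points of the orbit of `x`. -/
def orbitSet : Finset α := (Finset.range n).image (walk f r x)

variable (f x r n) in
/-- The number of points of the orbit below `v`. -/
def orbitRank (v : α) : ℕ := ((orbitSet f x r n).filter (· < v)).card

variable (f x r n) in
/-- The number of points of the orbit that are at least `x`. -/
def orbitTop : ℕ := ((orbitSet f x r n).filter (x ≤ ·)).card

include hr hret hmin in
theorem card_orbitSet : (orbitSet f x r n).card = n := by
  rw [orbitSet, Finset.card_image_of_injOn (walk_injOn_return hr hret hmin), Finset.card_range]

include hr hn hret in
theorem walk_mem_orbitSet (t : ℕ) : walk f r x t ∈ orbitSet f x r n :=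
  Finset.mem_image.2 ⟨t % n, Finset.mem_range.2 (Nat.mod_lt _ hn), walk_mod_return hr hret t⟩

include hr hn hret in
theorem exists_walk_succ {o : α} (ho : o ∈ orbitSet f x r n) : ∃ m, o = walk f r x (m + 1) := by
  obtain ⟨t, -, rfl⟩ := Finset.mem_image.1 ho
  refine ⟨t + n - 1, ?_⟩
  rw [show t + n - 1 + 1 = t + n by omega, walk_add_return hr hret]

include hr hret hmin in
theorem orbitRank_self : orbitRank f x r n x + orbitTop f x r n = n := by
  have h := Finset.card_filter_add_card_filter_not (s := orbitSet f x r n) (fun o => o < x)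
  rw [card_orbitSet hr hret hmin] at h
  simpa [orbitRank, orbitTop] using h

include hr hn hret in
theorem orbitTop_pos : 0 < orbitTop f x r n :=
  Finset.card_pos.2 ⟨x, Finset.mem_filter.2 ⟨walk_mem_orbitSet hr hn hret 0, le_rfl⟩⟩

theorem orbitRank_mono : Monotone (orbitRank f x r n) := fun _ _ h =>
  Finset.card_le_card fun _ ho => by
    simp only [Finset.mem_filter] at ho ⊢
    exact ⟨ho.1, ho.2.trans_le h⟩

theorem orbitRank_lt {o v : α} (ho : o ∈ orbitSet f x r n) (h : o < v) :
    orbitRank f x r n o < orbitRank f x r n v :=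
  Finset.card_lt_card <| by
    rw [Finset.ssubset_iff_of_subset fun p hp => by
      simp only [Finset.mem_filter] at hp ⊢; exact ⟨hp.1, hp.2.trans h⟩]
    exact ⟨o, by simp [ho, h], by simp⟩

include hf hlt hcomm hr hn hret

theorem walk_mem_Icc (t : ℕ) : f true x ≤ walk f r x t ∧ walk f r x t ≤ f false x := by
  obtain ⟨hx1, hx0⟩ := map_true_le_and_le_map_false hf hlt hr hn hret
  induction t with
  | zero => exact ⟨hx1, hx0⟩
  | succ t ih =>
    rcases map_mem_Icc hf hcomm hx1 hx0 ih.1 ih.2 (r t) with h | ⟨h, h'⟩ | ⟨h, h'⟩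
    · exact h
    · exact (((hr t).1 h).not_gt h').elim
    · rw [(hr t).2 h'.le] at h; simp at h

/-- The threshold map is increasing on each side of `x`, and `hcomm` places the images of active
points below those of passive points. Together with `orbitRank_map_false` this says that ranks move
by the rotation `+ orbitTop` modulo `n`. -/
theorem orbitRank_map_true {v : α} (hv : v ≤ f false x) (hxv : x ≤ v) :
    orbitRank f x r n (f true v) + orbitRank f x r n x = orbitRank f x r n v := by
  obtain ⟨hx1, hx0⟩ := map_true_le_and_le_map_false hf hlt hr hn hret
  have e : (orbitSet f x r n).filter (· < f true v) =
      ((orbitSet f x r n).filter (fun o => x ≤ o ∧ o < v)).image (f true) := by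
    ext o
    simp only [Finset.mem_filter, Finset.mem_image]
    constructor
    · rintro ⟨ho, hov⟩
      obtain ⟨m, rfl⟩ := exists_walk_succ hr hn hret ho
      rw [walk] at hov
      rcases hm : r m with _ | _
      · rw [hm] at hov
        have h1 := (hf false).monotone (walk_mem_Icc hf hlt hcomm hr hn hret m).1
        have h2 := (hf true).monotone hv
        exact absurd (hov.trans_le (h2.trans ((hcomm x).le.trans h1))) (lt_irrefl _)
      · rw [hm] at hov
        exact ⟨walk f r x m, ⟨walk_mem_orbitSet hr hn hret m, (hr m).1 hm,
          (hf true).lt_iff_lt.1 hov⟩, by rw [walk, hm]⟩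
    · rintro ⟨o, ⟨ho, hxo, hov⟩, rfl⟩
      obtain ⟨m, -, rfl⟩ := Finset.mem_image.1 ho
      refine ⟨?_, hf true hov⟩
      rw [← (hr m).2 hxo]
      exact walk_mem_orbitSet hr hn hret (m + 1)
  have h := Finset.card_filter_add_card_filter_not
    (s := (orbitSet f x r n).filter (· < v)) (fun o => x ≤ o)
  rw [Finset.filter_filter, Finset.filter_filter] at h
  rw [orbitRank, e, Finset.card_image_of_injective _ (hf true).injective, orbitRank, orbitRank, ← h]
  congr 2
  · ext o; simp [and_comm]
  · ext o
    simp only [Finset.mem_filter, not_le]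
    exact ⟨fun h => ⟨h.1, h.2.trans_le hxv, h.2⟩, fun h => ⟨h.1, h.2.2⟩⟩

theorem orbitRank_map_false {v : α} (hv : f true x ≤ v) (hvx : v ≤ x) :
    orbitRank f x r n (f false v) = orbitTop f x r n + orbitRank f x r n v := by
  obtain ⟨hx1, hx0⟩ := map_true_le_and_le_map_false hf hlt hr hn hret
  have hsep : ∀ o ∈ orbitSet f x r n, ∀ w, f true x ≤ w → f true o < f false w := by
    intro o ho w hw
    obtain ⟨m, -, rfl⟩ := Finset.mem_image.1 ho
    have h1 := (hf true).monotone (walk_mem_Icc hf hlt hcomm hr hn hret m).2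
    exact h1.trans_lt ((hcomm x).trans_le ((hf false).monotone hw))
  have e : (orbitSet f x r n).filter (· < f false v) =
      ((orbitSet f x r n).filter (x ≤ ·)).image (f true) ∪
        ((orbitSet f x r n).filter (· < v)).image (f false) := by
    ext o
    simp only [Finset.mem_filter, Finset.mem_image, Finset.mem_union]
    constructor
    · rintro ⟨ho, hov⟩
      obtain ⟨m, rfl⟩ := exists_walk_succ hr hn hret ho
      rw [walk] at hov
      rcases hm : r m with _ | _
      · rw [hm] at hov
        exact Or.inr ⟨walk f r x m, ⟨walk_mem_orbitSet hr hn hret m,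
          (hf false).lt_iff_lt.1 hov⟩, by rw [walk, hm]⟩
      · exact Or.inl ⟨walk f r x m, ⟨walk_mem_orbitSet hr hn hret m, (hr m).1 hm⟩,
          by rw [walk, hm]⟩
    · rintro (⟨o, ⟨ho, hxo⟩, rfl⟩ | ⟨o, ⟨ho, hov⟩, rfl⟩)
      · obtain ⟨m, -, rfl⟩ := Finset.mem_image.1 ho
        refine ⟨?_, hsep _ ho v hv⟩
        rw [← (hr m).2 hxo]
        exact walk_mem_orbitSet hr hn hret (m + 1)
      · obtain ⟨m, -, rfl⟩ := Finset.mem_image.1 ho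
        refine ⟨?_, hf false hov⟩
        have : r m = false := by
          rw [← Bool.not_eq_true, hr]; exact not_le.2 (hov.trans_le hvx)
        rw [← this]
        exact walk_mem_orbitSet hr hn hret (m + 1)
  rw [orbitRank, e, Finset.card_union_of_disjoint, Finset.card_image_of_injective _ (hf _).injective,
    Finset.card_image_of_injective _ (hf _).injective]
  · rfl
  · rw [Finset.disjoint_left]
    intro p hp hp'
    obtain ⟨o, ho, rfl⟩ := Finset.mem_image.1 hp
    obtain ⟨o', ho', h⟩ := Finset.mem_image.1 hp'
    obtain ⟨m, -, e⟩ := Finset.mem_image.1 (Finset.mem_filter.1 ho').1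
    have := hsep o (Finset.mem_filter.1 ho).1 o'
      (e ▸ (walk_mem_Icc hf hlt hcomm hr hn hret m).1)
    exact this.ne' h

include hmin

/-- The rotation starts at rank `n - orbitTop`, the rank of `x`; hence the offset `t - 1`. -/
theorem orbitRank_walk (t : ℕ) :
    (orbitRank f x r n (walk f r x t) : ℤ) = (((t : ℤ) - 1) * orbitTop f x r n) % n := by
  have hself := orbitRank_self hr hret hmin
  have hlt' : ∀ t, orbitRank f x r n (walk f r x t) < n := fun t => by
    conv_rhs => rw [← card_orbitSet hr hret hmin]
    exact Finset.card_lt_card (Finset.filter_ssubset.2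
      ⟨_, walk_mem_orbitSet hr hn hret t, lt_irrefl _⟩)
  suffices H : ∃ q : ℤ, (orbitRank f x r n (walk f r x t) : ℤ) =
      ((t : ℤ) - 1) * orbitTop f x r n + n * q by
    obtain ⟨q, hq⟩ := H
    rw [← Int.add_mul_emod_self_left _ _ q, ← hq, Int.emod_eq_of_lt (by positivity)]
    exact_mod_cast hlt' t
  induction t with
  | zero => exact ⟨1, by simp only [walk]; push_cast; linarith⟩
  | succ t ih =>
    obtain ⟨q, hq⟩ := ih
    obtain ⟨h1, h0⟩ := walk_mem_Icc hf hlt hcomm hr hn hret t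
    rw [walk]
    rcases ht : r t with _ | _
    · have hle : walk f r x t ≤ x := by
        refine (not_le.1 fun h => ?_).le
        rw [(hr t).2 h] at ht; simp at ht
      refine ⟨q, ?_⟩
      rw [orbitRank_map_false hf hlt hcomm hr hn hret h1 hle]
      push_cast
      rw [hq]; ring
    · have h2 := orbitRank_map_true hf hlt hcomm hr hn hret h0 ((hr t).1 ht)
      refine ⟨q - 1, ?_⟩
      zify at h2 hself
      push_cast
      linarith

theorem return_word_iff (t : ℕ) :
    r t = true ↔ (n : ℤ) - orbitTop f x r n ≤ (((t : ℤ) - 1) * orbitTop f x r n) % n := by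
  have hself := orbitRank_self hr hret hmin
  rw [← orbitRank_walk hf hlt hcomm hr hn hret hmin, hr]
  have : (n : ℤ) - orbitTop f x r n ≤ orbitRank f x r n (walk f r x t) ↔
      orbitRank f x r n x ≤ orbitRank f x r n (walk f r x t) := by omega
  rw [this]
  refine ⟨fun h => orbitRank_mono h, fun h => ?_⟩
  by_contra! h'
  exact (orbitRank_lt (walk_mem_orbitSet hr hn hret t) h').not_ge h

variable {v : ℕ → Bool} (hv : ∀ t, v t = true ↔ x < walk f v x t)

include hv

/-- The same rotation governs the orbit of `v`, whose points need not belong to the returning orbit.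
After the first step its ranks lie in `1, …, n` instead of `0, …, n - 1`, so one is subtracted
before reducing modulo `n`. -/
theorem orbitRank_other_walk (t : ℕ) :
    0 < orbitRank f x r n (walk f v x (t + 1)) ∧
    ((orbitRank f x r n (walk f v x (t + 1)) : ℤ) - 1 =
      ((t : ℤ) * orbitTop f x r n - 1) % n) := by
  obtain ⟨hx1, hx0⟩ := map_true_le_and_le_map_false hf hlt hr hn hret
  have hself := orbitRank_self hr hret hmin
  have htop := orbitTop_pos hr hn hret
  have hxO := walk_mem_orbitSet hr hn hret 0
  suffices H : (f true x ≤ walk f v x (t + 1) ∧ walk f v x (t + 1) ≤ f false x) ∧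
      0 < orbitRank f x r n (walk f v x (t + 1)) ∧ orbitRank f x r n (walk f v x (t + 1)) ≤ n ∧
      ∃ q : ℤ, (orbitRank f x r n (walk f v x (t + 1)) : ℤ) = t * orbitTop f x r n + n * q by
    obtain ⟨-, h1, h2, q, hq⟩ := H
    refine ⟨h1, ?_⟩
    rw [← Int.add_mul_emod_self_left _ _ q,
      show (t : ℤ) * orbitTop f x r n - 1 + n * q =
        (orbitRank f x r n (walk f v x (t + 1)) : ℤ) - 1 by rw [hq]; ring, Int.emod_eq_of_lt]
    · omega
    · omega
  induction t with
  | zero =>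
    have hv0 : v 0 = false := by rw [← Bool.not_eq_true, hv]; exact lt_irrefl _
    have hm := orbitRank_map_false hf hlt hcomm hr hn hret hx1 le_rfl
    have e : walk f v x (0 + 1) = f false x := by simp [walk, hv0]
    rw [e]
    exact ⟨⟨hx1.trans hx0, le_rfl⟩, by omega, by omega, 1, by rw [hm]; push_cast; linarith⟩
  | succ t ih =>
    obtain ⟨⟨h1, h0⟩, hpos, hle, q, hq⟩ := ih
    have hI := map_mem_Icc hf hcomm hx1 hx0 h1 h0 (v (t + 1))
    rw [walk]
    rcases ht : v (t + 1) with _ | _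
    · have hle' : walk f v x (t + 1) ≤ x := by
        refine not_lt.1 fun h => ?_
        rw [(hv _).2 h] at ht; simp at ht
      have hm := orbitRank_map_false hf hlt hcomm hr hn hret h1 hle'
      have hmono := orbitRank_mono (f := f) (x := x) (r := r) (n := n) hle'
      rw [ht] at hI
      refine ⟨hI.resolve_right ?_, by omega, by omega, q, ?_⟩
      · rintro (⟨h, -⟩ | ⟨-, h⟩)
        · simp at h
        · exact h.not_ge hle'
      · rw [hm]; push_cast; rw [hq]; ring
    · have hgt := (hv _).1 ht
      have hm := orbitRank_map_true hf hlt hcomm hr hn hret h0 hgt.le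
      have hmono : orbitRank f x r n x < _ := orbitRank_lt hxO hgt
      rw [ht] at hI
      refine ⟨hI.resolve_right ?_, by omega, by omega, q - 1, ?_⟩
      · rintro (⟨-, h⟩ | ⟨h, -⟩)
        · exact h.not_gt hgt
        · simp at h
      · zify at hm hself
        push_cast
        linarith

theorem other_word_iff (t : ℕ) :
    v (t + 1) = true ↔ (n : ℤ) - orbitTop f x r n ≤ ((t : ℤ) * orbitTop f x r n - 1) % n := by
  obtain ⟨-, h⟩ := orbitRank_other_walk hf hlt hcomm hr hn hret hmin hv t
  have hself := orbitRank_self hr hret hmin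
  rw [← h, hv]
  have hxO := walk_mem_orbitSet hr hn hret 0
  constructor
  · intro h
    have := orbitRank_lt hxO h
    simp only [walk] at this ⊢
    omega
  · intro h
    by_contra! h'
    have := orbitRank_mono (f := f) (x := x) (r := r) (n := n) h'
    omega

/-- Since `t + 1` is `-s` modulo `n`, the residues that decide the two actions are mirror images
under `le_emod_reflect`. -/
theorem other_word_eq_reverse {t s m : ℕ} (h : t + 1 + s = m * n) : v (t + 2) = r s := by
  have hself := orbitRank_self hr hret hmin
  rw [Bool.eq_iff_iff, other_word_iff hf hlt hcomm hr hn hret hmin hv (t + 1),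
    return_word_iff hf hlt hcomm hr hn hret hmin, le_emod_reflect (by omega) (by omega) (by omega)]
  have hz : (t : ℤ) + 1 + s = m * n := by exact_mod_cast h
  have : -(orbitTop f x r n : ℤ) - 1 - (((t + 1 : ℕ) : ℤ) * orbitTop f x r n - 1) =
      ((s : ℤ) - 1) * orbitTop f x r n + n * (-m * orbitTop f x r n) := by
    push_cast
    rw [show (s : ℤ) = m * n - t - 1 by linarith]; ring
  rw [this, Int.add_mul_emod_self_left]

/-- The word `v` that starts with the other action is `0 1 B`, where `B` spells the returning word
`r` backwards; and the first period of `r` followed by `v` is `1 0 B`. -/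
theorem return_words :
    (∃ y : ℕ → α, y 0 = x ∧ ∀ j, y j = f (v (j + 2)) (y (j + 1))) ∧
    v 0 = false ∧ v 1 = true ∧
    (∀ t, (if t < n then r t else v (t - n)) =
      if t = 0 then true else if t = 1 then false else v t) ∧
    ∀ t, 0 < t → walk f v x t ≠ x := by
  obtain ⟨hx1, hx0⟩ := map_true_le_and_le_map_false hf hlt hr hn hret
  have hself := orbitRank_self hr hret hmin
  have htop := orbitTop_pos hr hn hret
  have hw := return_word_iff hf hlt hcomm hr hn hret hmin
  have hrk := orbitRank_walk hf hlt hcomm hr hn hret hmin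
  have ho := other_word_iff hf hlt hcomm hr hn hret hmin hv
  have hork := orbitRank_other_walk hf hlt hcomm hr hn hret hmin hv
  have hr0 : r 0 = true := (hr 0).2 le_rfl
  have hv0 : v 0 = false := by rw [← Bool.not_eq_true, hv]; exact lt_irrefl _
  have hv1 : v 1 = true := by
    rw [ho 0]
    have : ((0 : ℕ) : ℤ) * orbitTop f x r n - 1 = ((n : ℤ) - 1) + n * (-1) := by push_cast; ring
    rw [this, Int.add_mul_emod_self_left, Int.emod_eq_of_lt] <;> omega
  have hper : ∀ t, v (t + 1 + n) = v (t + 1) := by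
    intro t
    rw [Bool.eq_iff_iff, show t + 1 + n = (t + n) + 1 by ring, ho, ho]
    have : ((t + n : ℕ) : ℤ) * orbitTop f x r n - 1 =
      (t : ℤ) * orbitTop f x r n - 1 + n * orbitTop f x r n := by push_cast; ring
    rw [this, Int.add_mul_emod_self_left]
  have hr1 : 1 < n → r 1 = false := by
    intro h1
    have h2 := hmin 1 one_pos h1
    have h3 : walk f r x 1 = f true x := by simp [walk, hr0]
    rw [← Bool.not_eq_true, hr, h3, not_le]
    exact lt_of_le_of_ne hx1 (h3 ▸ h2)
  have htopn : 1 < n → orbitTop f x r n < n := by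
    intro h1
    have := hw 1
    rw [hr1 h1] at this
    simp at this
    omega
  have hvn : 1 < n → v n = false := by
    intro h1
    obtain ⟨m, rfl⟩ : ∃ m, n = m + 1 := ⟨n - 1, by omega⟩
    have := htopn h1
    rw [← Bool.not_eq_true, ho]
    have e : (m : ℤ) * orbitTop f x r (m + 1) - 1 = (((m + 1 : ℕ) : ℤ) -
        orbitTop f x r (m + 1) - 1) + ((m + 1 : ℕ) : ℤ) * (orbitTop f x r (m + 1) - 1) := by
      push_cast; ring
    rw [e, Int.add_mul_emod_self_left, Int.emod_eq_of_lt] <;> omega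
  have hcat : ∀ t, (if t < n then r t else v (t - n)) =
      if t = 0 then true else if t = 1 then false else v t := by
    intro t
    rcases t with _ | t
    · simp [hn, hr0]
    rcases t with _ | t
    · by_cases h1 : 1 < n
      · simp [h1, hr1 h1]
      · have : n = 1 := by omega
        subst this
        simp [hv0]
    · have e0 : ¬ (t + 1 + 1 = 0) := by omega
      have e1 : ¬ (t + 1 + 1 = 1) := by omega
      rw [if_neg e0, if_neg e1]
      -- Inside the first period one criterion tests the rank and the other the rank minus one. They
      -- can differ only at rank zero or at the rank of `x`, which belong to the times `1` and `0`.
      by_cases h : t + 1 + 1 < n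
      · rw [if_pos h, Bool.eq_iff_iff, hw, ho (t + 1)]
        have hne1 : orbitRank f x r n (walk f r x (t + 1 + 1)) ≠ orbitRank f x r n x := by
          intro e
          rcases lt_trichotomy (walk f r x (t + 1 + 1)) x with h' | h' | h'
          · exact (orbitRank_lt (walk_mem_orbitSet hr hn hret _) h').ne e
          · exact hmin _ (by omega) h h'
          · exact (orbitRank_lt (walk_mem_orbitSet hr hn hret 0) h').ne' e
        have hz1 : orbitRank f x r n (walk f r x 1) = 0 := by
          have := hrk 1
          simpa using this
        have hne0 : orbitRank f x r n (walk f r x (t + 1 + 1)) ≠ 0 := by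
          intro e
          rcases lt_trichotomy (walk f r x (t + 1 + 1)) (walk f r x 1) with h' | h' | h'
          · have := orbitRank_lt (walk_mem_orbitSet hr hn hret _) h'
            omega
          · have := walk_injOn_return hr hret hmin (by simp [h]) (by simp; omega) h'
            omega
          · have := orbitRank_lt (walk_mem_orbitSet hr hn hret 1) h'
            omega
        have e1 := hrk (t + 1 + 1)
        have hlt' : orbitRank f x r n (walk f r x (t + 1 + 1)) < n := by
          have := Int.emod_lt_of_pos ((((t + 1 + 1 : ℕ) : ℤ) - 1) * orbitTop f x r n)
            (show (0 : ℤ) < n by omega)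
          omega
        have e2 : ((t + 1 : ℕ) : ℤ) * orbitTop f x r n - 1 =
            ((orbitRank f x r n (walk f r x (t + 1 + 1)) : ℤ) - 1) +
              n * (((((t + 1 + 1 : ℕ) : ℤ) - 1) * orbitTop f x r n) / n) := by
          have := Int.mul_ediv_add_emod ((((t + 1 + 1 : ℕ) : ℤ) - 1) * orbitTop f x r n) n
          rw [← e1] at this
          have e3 : ((t + 1 : ℕ) : ℤ) = ((t + 1 + 1 : ℕ) : ℤ) - 1 := by push_cast; ring
          rw [e3]
          linarith
        rw [← e1, e2, Int.add_mul_emod_self_left, Int.emod_eq_of_lt (by omega) (by omega)]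
        omega
      · rw [if_neg h]
        rcases Nat.lt_or_ge n (t + 1 + 1) with h' | h'
        · obtain ⟨s, hs⟩ : ∃ s, t + 1 + 1 = s + 1 + n := ⟨t + 1 - n, by omega⟩
          rw [hs, hper, Nat.add_sub_cancel]
        · have : n = t + 1 + 1 := by omega
          rw [← this, Nat.sub_self, hv0, hvn (by omega)]
  refine ⟨⟨fun j => walk f r x (j * (n - 1)), by simp [walk], fun j => ?_⟩, hv0, hv1, hcat, ?_⟩
  -- The witness `y` reads the returning orbit backwards: a step of `n - 1` is a step of `-1` modulo
  -- the period.
  · have hs : j + 1 + (j + 1) * (n - 1) = (j + 1) * n := by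
      obtain ⟨m, rfl⟩ : ∃ m, n = m + 1 := ⟨n - 1, by omega⟩
      simp; ring
    rw [other_word_eq_reverse hf hlt hcomm hr hn hret hmin hv hs]
    change _ = walk f r x ((j + 1) * (n - 1) + 1)
    change walk f r x (j * (n - 1)) = _
    rw [← walk_add_return hr hret (j * (n - 1))]
    congr 1
    obtain ⟨m, rfl⟩ : ∃ m, n = m + 1 := ⟨n - 1, by omega⟩
    simp; ring
  -- A return along `v` could only occur at a multiple of `n`. But one period of `v` has `01` where
  -- `r` has `10`, so by `hcomm` it sends `x` strictly below `x`, and iterating it keeps the orbit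
  -- below.
  · intro t ht hx
    obtain ⟨s, rfl⟩ : ∃ s, t = s + 1 := ⟨t - 1, by omega⟩
    obtain ⟨hp, he⟩ := hork s
    rw [hx] at hp he
    have h1n : 1 < n := by
      by_contra! h
      have : n = 1 := by omega
      subst this
      omega
    have hzx : walk f r x (s + 1) = x := by
      have hk := hrk (s + 1)
      have e : orbitRank f x r n (walk f r x (s + 1)) = orbitRank f x r n x := by
        zify
        rw [hk]
        have := Int.mul_ediv_add_emod ((s : ℤ) * orbitTop f x r n - 1) n
        rw [← he] at this
        rw [show (((s + 1 : ℕ) : ℤ) - 1) * orbitTop f x r n = (orbitRank f x r n x : ℤ) +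
          n * (((s : ℤ) * orbitTop f x r n - 1) / n) by push_cast; linarith,
          Int.add_mul_emod_self_left, Int.emod_eq_of_lt] <;> omega
      rcases lt_trichotomy (walk f r x (s + 1)) x with h' | h' | h'
      · exact ((orbitRank_lt (walk_mem_orbitSet hr hn hret _) h').ne e).elim
      · exact h'
      · exact ((orbitRank_lt (walk_mem_orbitSet hr hn hret 0) h').ne' e).elim
    have hdvd : n ∣ s + 1 := by
      rw [← walk_mod_return hr hret] at hzx
      by_contra h
      exact hmin _ (Nat.pos_of_ne_zero fun h' => h (Nat.dvd_of_mod_eq_zero h'))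
        (Nat.mod_lt _ hn) hzx
    obtain ⟨j, hj⟩ := hdvd
    have hfirst : walk f v x n < x := by
      obtain ⟨m, rfl⟩ : ∃ m, n = 2 + m := ⟨n - 2, by omega⟩
      conv_rhs => rw [← hret]
      rw [walk_add, walk_add]
      have e : walk f (fun s => v (2 + s)) (walk f v x 2) m =
          walk f (fun s => r (2 + s)) (walk f v x 2) m := by
        refine walk_congr f _ (T := m) (fun t ht => ?_) m le_rfl
        have := hcat (2 + t)
        rw [if_pos (by omega), if_neg (by omega), if_neg (by omega)] at this
        exact this.symm
      rw [e]
      refine walk_strictMono hf _ m ?_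
      simp only [walk, hv0, hv1, hr0, hr1 h1n]
      exact hcomm x
    have hvper : ∀ t, v (n + t) = v t := by
      intro t
      rw [add_comm]
      rcases t with _ | t
      · rw [zero_add, hvn h1n, hv0]
      · exact hper t
    have hall : ∀ j, walk f v x (n * (j + 1)) < x := by
      intro j
      induction j with
      | zero => simpa using hfirst
      | succ j ih =>
        rw [Nat.mul_succ, add_comm, walk_add]
        have : (fun s => v (n + s)) = v := funext hvper
        rw [this]
        have hlt2 : walk f v (walk f v x n) (n * (j + 1)) < walk f v x (n * (j + 1)) :=
          walk_strictMono hf v _ hfirst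
        exact hlt2.trans ih
    obtain ⟨i, rfl⟩ : ∃ i, j = i + 1 := ⟨j - 1, by
      rcases j with _ | j
      · simp at hj
      · simp⟩
    rw [hj] at hx
    exact (hall i).ne hx

end Return

/-! ### Order duality -/

section ReturnDual

variable {α : Type*} [LinearOrder α] {f : Bool → α → α}

/-- The family of maps seen from the reversed order, with the two actions exchanged. -/
def dualMap (f : Bool → α → α) (c : Bool) (z : αᵒᵈ) : αᵒᵈ :=
  OrderDual.toDual (f (!c) (OrderDual.ofDual z))

omit [LinearOrder α] in
theorem walk_dualMap (f : Bool → α → α) (u : ℕ → Bool) (x : α) (t : ℕ) :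
    walk (dualMap f) (fun t => !u t) (OrderDual.toDual x) t = OrderDual.toDual (walk f u x t) := by
  induction t with
  | zero => rfl
  | succ t ih => simp [walk, ih, dualMap]

/-- The counterpart of `return_words` for a word that starts with the action `false`. -/
theorem return_words_dual (hf : ∀ c, StrictMono (f c))
    (hlt : ∀ z, f true z < f false z) (hcomm : ∀ z, f true (f false z) < f false (f true z))
    {x : α} {r : ℕ → Bool} (hr : ∀ t, r t = true ↔ x < walk f r x t)
    {n : ℕ} (hn : 0 < n) (hret : walk f r x n = x)
    (hmin : ∀ t, 0 < t → t < n → walk f r x t ≠ x)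
    {v : ℕ → Bool} (hv : ∀ t, v t = true ↔ x ≤ walk f v x t) :
    (∃ y : ℕ → α, y 0 = x ∧ ∀ j, y j = f (v (j + 2)) (y (j + 1))) ∧
    v 0 = true ∧ v 1 = false ∧
    (∀ t, (if t < n then r t else v (t - n)) =
      if t = 0 then false else if t = 1 then true else v t) ∧
    ∀ t, 0 < t → walk f v x t ≠ x := by
  have hf' : ∀ c, StrictMono (dualMap f c) := fun c _ _ hab => hf (!c) hab
  have hlt' : ∀ z, dualMap f true z < dualMap f false z := fun z => hlt (OrderDual.ofDual z)
  have hcomm' : ∀ z, dualMap f true (dualMap f false z) < dualMap f false (dualMap f true z) :=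
    fun z => hcomm (OrderDual.ofDual z)
  obtain ⟨⟨y, hy0, hy⟩, h0, h1, hcat, hne⟩ := return_words hf' hlt' hcomm'
    (x := OrderDual.toDual x) (r := fun t => !r t) (v := fun t => !v t) (n := n)
    (fun t => by
      rw [walk_dualMap, OrderDual.toDual_le_toDual, ← not_lt, ← hr]; simp) hn
    (by rw [walk_dualMap, hret]) (fun t h0 h1 => by
      rw [walk_dualMap]; exact fun h => hmin t h0 h1 (OrderDual.toDual.injective h))
    (fun t => by
      rw [walk_dualMap, OrderDual.toDual_lt_toDual, ← not_le, ← hv]; simp)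
  refine ⟨⟨fun j => OrderDual.ofDual (y j), ?_, fun j => ?_⟩, by simpa using h0, by simpa using h1,
    fun t => ?_, fun t ht h => hne t ht ?_⟩
  · simp [hy0]
  · change OrderDual.ofDual (y j) = _
    rw [hy j]; simp [dualMap]
  · have := hcat t
    split_ifs at this ⊢ <;> simpa using this
  · rw [walk_dualMap, h]

end ReturnDual

/-! ### The error-variance maps -/

/-- The coefficient of `φ` that belongs to an action. -/
def gain (a b : ℝ) (c : Bool) : ℝ := if c then b else a

theorem phi_eq (a b : ℝ) (c : Bool) (x : ℝ) :
    phi a b c x = (x + 1) / (gain a b c * (x + 1) + 1) := by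
  cases c <;> simp [phi, gain] <;> ring_nf

section Phi

variable {a b : ℝ} (ha : 0 ≤ a) (hab : a < b)

include ha hab

theorem gain_nonneg (c : Bool) : 0 ≤ gain a b c := by
  cases c <;> simp [gain] <;> linarith

theorem gain_mul_pos (c : Bool) {x : ℝ} (hx : 0 ≤ x) : 0 < gain a b c * (x + 1) + 1 := by
  have := gain_nonneg ha hab c
  positivity

theorem phi_pos (c : Bool) {x : ℝ} (hx : 0 ≤ x) : 0 < phi a b c x := by
  rw [phi_eq]
  have := gain_mul_pos ha hab c hx
  positivity

theorem phi_le_add_one (c : Bool) {x : ℝ} (hx : 0 ≤ x) : phi a b c x ≤ x + 1 := by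
  rw [phi_eq, div_le_iff₀ (gain_mul_pos ha hab c hx)]
  nlinarith [mul_nonneg (gain_nonneg ha hab c) (sq_nonneg (x + 1))]

theorem phi_lt_phi (c : Bool) {x y : ℝ} (hx : 0 ≤ x) (hxy : x < y) :
    phi a b c x < phi a b c y := by
  rw [phi_eq, phi_eq, div_lt_div_iff₀ (gain_mul_pos ha hab c hx)
    (gain_mul_pos ha hab c (hx.trans hxy.le))]
  nlinarith

theorem phi_sub_le (c : Bool) {x y : ℝ} (hx : 0 ≤ x) (hxy : x ≤ y) :
    phi a b c y - phi a b c x ≤ y - x := by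
  have h1 := gain_mul_pos ha hab c hx
  have h2 := gain_mul_pos ha hab c (hx.trans hxy)
  have hg := gain_nonneg ha hab c
  rw [phi_eq, phi_eq, div_sub_div _ _ h2.ne' h1.ne', div_le_iff₀ (mul_pos h2 h1)]
  have : 1 ≤ (gain a b c * (y + 1) + 1) * (gain a b c * (x + 1) + 1) := by
    have h3 : 0 ≤ gain a b c * (y + 1) := by have := hx.trans hxy; positivity
    have h4 : 0 ≤ gain a b c * (x + 1) := by positivity
    nlinarith [mul_nonneg h3 h4]
  nlinarith [mul_le_mul_of_nonneg_left this (sub_nonneg.2 hxy)]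

theorem phi_true_lt_phi_false {x : ℝ} (hx : 0 ≤ x) : phi a b true x < phi a b false x := by
  rw [phi_eq, phi_eq]
  have h1 := gain_mul_pos ha hab true hx
  have h2 := gain_mul_pos ha hab false hx
  simp only [gain] at *
  apply div_lt_div_of_pos_left (by linarith) h2
  simp only [if_true, Bool.false_eq_true, if_false]
  nlinarith

theorem phi_true_phi_false_lt {x : ℝ} (hx : 0 ≤ x) :
    phi a b true (phi a b false x) < phi a b false (phi a b true x) := by
  have h1 := gain_mul_pos ha hab true hx
  have h2 := gain_mul_pos ha hab false hx
  have h3 := gain_mul_pos ha hab true (phi_pos ha hab false hx).le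
  have h4 := gain_mul_pos ha hab false (phi_pos ha hab true hx).le
  rw [phi_eq a b true, phi_eq a b false (phi a b true x), div_lt_div_iff₀ h3 h4]
  rw [phi_eq a b true, phi_eq a b false]
  simp only [gain, if_true, Bool.false_eq_true, if_false] at *
  rw [← sub_pos]
  have hb : 0 < b := ha.trans_lt hab
  have e : ((x + 1) / (b * (x + 1) + 1) + 1) * (b * ((x + 1) / (a * (x + 1) + 1) + 1) + 1) -
      ((x + 1) / (a * (x + 1) + 1) + 1) * (a * ((x + 1) / (b * (x + 1) + 1) + 1) + 1) =
      (b - a) * (1 + (a + b) * (x + 1) + 2 * (x + 1) + a * b * (x + 1) ^ 2 +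
        (a + b) * (x + 1) ^ 2) / ((b * (x + 1) + 1) * (a * (x + 1) + 1)) := by
    field_simp
    ring
  rw [e]
  have : 0 < b - a := by linarith
  have hx1 : 0 ≤ a * b * (x + 1) ^ 2 := by positivity
  have hx2 : 0 ≤ (a + b) * (x + 1) := by positivity
  have hx3 : 0 ≤ (a + b) * (x + 1) ^ 2 := by positivity
  apply div_pos (mul_pos this _) (mul_pos h1 h2)
  linarith

theorem phi_true_lt_inv {x : ℝ} (hx : 0 ≤ x) : phi a b true x < 1 / b := by
  have h1 := gain_mul_pos ha hab true hx
  rw [phi_eq]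
  simp only [gain, if_true] at *
  rw [div_lt_div_iff₀ h1 (by linarith)]
  linarith

theorem traj_nonneg (u : ℕ → Bool) {x : ℝ} (hx : 0 ≤ x) (t : ℕ) : 0 ≤ traj a b u x t := by
  cases t with
  | zero => exact hx
  | succ t =>
    induction t with
    | zero => exact (phi_pos ha hab _ hx).le
    | succ t ih => exact (phi_pos ha hab _ ih).le

theorem traj_le_add (u : ℕ → Bool) {x : ℝ} (hx : 0 ≤ x) (t : ℕ) : traj a b u x t ≤ x + t := by
  induction t with
  | zero => simp [traj]
  | succ t ih =>
    have := phi_le_add_one ha hab (u t) (traj_nonneg ha hab u hx t)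
    simp only [traj]
    push_cast
    linarith

theorem traj_lt_traj (u : ℕ → Bool) {x y : ℝ} (hx : 0 ≤ x) (hxy : x < y) (t : ℕ) :
    traj a b u x t < traj a b u y t := by
  induction t with
  | zero => exact hxy
  | succ t ih => exact phi_lt_phi ha hab _ (traj_nonneg ha hab u hx t) ih

theorem traj_le_traj (u : ℕ → Bool) {x y : ℝ} (hx : 0 ≤ x) (hxy : x ≤ y) (t : ℕ) :
    traj a b u x t ≤ traj a b u y t := by
  rcases hxy.eq_or_lt with rfl | h
  · exact le_rfl
  · exact (traj_lt_traj ha hab u hx h t).le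

theorem traj_sub_le (u : ℕ → Bool) {x y : ℝ} (hx : 0 ≤ x) (hxy : x ≤ y) (t : ℕ) :
    traj a b u y t - traj a b u x t ≤ y - x := by
  induction t with
  | zero => exact le_rfl
  | succ t ih =>
    exact (phi_sub_le ha hab _ (traj_nonneg ha hab u hx t)
      (traj_le_traj ha hab u hx hxy t)).trans ih

omit ha hab in
theorem traj_congr {u u' : ℕ → Bool} (x : ℝ) {T : ℕ} (h : ∀ t < T, u t = u' t) :
    ∀ t ≤ T, traj a b u x t = traj a b u' x t := by
  intro t
  induction t with
  | zero => intro _; rfl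
  | succ t ih =>
    intro ht
    simp only [traj]
    rw [ih (by omega), h t (by omega)]

omit ha hab in
theorem traj_add (u : ℕ → Bool) (x : ℝ) (n t : ℕ) :
    traj a b u x (n + t) = traj a b (fun s => u (n + s)) (traj a b u x n) t := by
  induction t with
  | zero => rfl
  | succ t ih =>
    rw [← add_assoc]
    simp only [traj, ih]

end Phi

/-- The error-variance maps on the nonnegative reals. -/
def phiNN (a b : ℝ) (c : Bool) (z : NNReal) : NNReal := (phi a b c z).toNNReal

/-! ### Transfer of the word combinatorics to the error-variance maps -/

section PhiNN

variable {a b : ℝ} (ha : 0 ≤ a) (hab : a < b)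

include ha hab

theorem coe_phiNN (c : Bool) (z : NNReal) : (phiNN a b c z : ℝ) = phi a b c z :=
  Real.coe_toNNReal _ (phi_pos ha hab c z.2).le

theorem phiNN_strictMono (c : Bool) : StrictMono (phiNN a b c) := by
  intro x y hxy
  rw [← NNReal.coe_lt_coe, coe_phiNN ha hab, coe_phiNN ha hab]
  exact phi_lt_phi ha hab c x.2 hxy

theorem phiNN_lt (z : NNReal) : phiNN a b true z < phiNN a b false z := by
  rw [← NNReal.coe_lt_coe, coe_phiNN ha hab, coe_phiNN ha hab]
  exact phi_true_lt_phi_false ha hab z.2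

theorem phiNN_comm_lt (z : NNReal) :
    phiNN a b true (phiNN a b false z) < phiNN a b false (phiNN a b true z) := by
  rw [← NNReal.coe_lt_coe]
  simp only [coe_phiNN ha hab]
  exact phi_true_phi_false_lt ha hab z.2

theorem coe_walk (u : ℕ → Bool) (z : NNReal) (t : ℕ) :
    ((walk (phiNN a b) u z t : NNReal) : ℝ) = traj a b u z t := by
  induction t with
  | zero => rfl
  | succ t ih => rw [walk, coe_phiNN ha hab, ih, traj]

theorem count_le_count_of_traj {u u' : ℕ → Bool}
    (h : ∀ t, (∀ z, 0 ≤ z → traj a b u' z t ≤ traj a b u z t) → u' t = true → u t = true)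
    (t : ℕ) : count u' t ≤ count u t := by
  refine count_le_count (f := phiNN a b) (fun c => (phiNN_strictMono ha hab c).monotone)
    (fun z => (phiNN_comm_lt ha hab z).le) (fun t ht => h t fun z hz => ?_) t
  lift z to NNReal using hz
  have := ht z
  rwa [← NNReal.coe_le_coe, coe_walk ha hab, coe_walk ha hab] at this

theorem traj_return_words {z : ℝ} (hz : 0 ≤ z) {r v : ℕ → Bool}
    (hr : ∀ t, r t = true ↔ z ≤ traj a b r z t) (hv : ∀ t, v t = true ↔ z < traj a b v z t)
    {n : ℕ} (hn : 0 < n) (hret : traj a b r z n = z)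
    (hmin : ∀ t, 0 < t → t < n → traj a b r z t ≠ z) :
    (∃ y : ℕ → ℝ, y 0 = z ∧ (∀ j, 0 ≤ y j) ∧ ∀ j, y j = phi a b (v (j + 2)) (y (j + 1))) ∧
    v 0 = false ∧ v 1 = true ∧
    (∀ t, (if t < n then r t else v (t - n)) =
      if t = 0 then true else if t = 1 then false else v t) ∧
    ∀ t, 0 < t → traj a b v z t ≠ z := by
  lift z to NNReal using hz
  simp only [← coe_walk ha hab, NNReal.coe_le_coe, NNReal.coe_lt_coe, NNReal.coe_inj, ne_eq]
    at hr hv hret hmin ⊢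
  obtain ⟨⟨y, hy0, hy⟩, h⟩ := return_words (phiNN_strictMono ha hab) (phiNN_lt ha hab)
    (phiNN_comm_lt ha hab) hr hn hret hmin hv
  exact ⟨⟨fun j => y j, by simp [hy0], fun j => (y j).2, fun j => by
    rw [← coe_phiNN ha hab, ← hy]⟩, h⟩

theorem traj_return_words_dual {z : ℝ} (hz : 0 ≤ z) {r v : ℕ → Bool}
    (hr : ∀ t, r t = true ↔ z < traj a b r z t) (hv : ∀ t, v t = true ↔ z ≤ traj a b v z t)
    {n : ℕ} (hn : 0 < n) (hret : traj a b r z n = z)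
    (hmin : ∀ t, 0 < t → t < n → traj a b r z t ≠ z) :
    (∃ y : ℕ → ℝ, y 0 = z ∧ (∀ j, 0 ≤ y j) ∧ ∀ j, y j = phi a b (v (j + 2)) (y (j + 1))) ∧
    v 0 = true ∧ v 1 = false ∧
    (∀ t, (if t < n then r t else v (t - n)) =
      if t = 0 then false else if t = 1 then true else v t) ∧
    ∀ t, 0 < t → traj a b v z t ≠ z := by
  lift z to NNReal using hz
  simp only [← coe_walk ha hab, NNReal.coe_le_coe, NNReal.coe_lt_coe, NNReal.coe_inj, ne_eq]
    at hr hv hret hmin ⊢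
  obtain ⟨⟨y, hy0, hy⟩, h⟩ := return_words_dual (phiNN_strictMono ha hab) (phiNN_lt ha hab)
    (phiNN_comm_lt ha hab) hr hn hret hmin hv
  exact ⟨⟨fun j => y j, by simp [hy0], fun j => (y j).2, fun j => by
    rw [← coe_phiNN ha hab, ← hy]⟩, h⟩

end PhiNN

/-! ### Homogeneous coordinates -/

/-- The linear orbit of `(p, q)`: the error variance at time `t` is the ratio of the two
coordinates. -/
def lin (a b : ℝ) (u : ℕ → Bool) (p q : ℝ) : ℕ → ℝ × ℝ
  | 0 => (p, q)
  | t + 1 => ((lin a b u p q t).1 + (lin a b u p q t).2, (lin a b u p q t).2 +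
      gain a b (u t) * ((lin a b u p q t).1 + (lin a b u p q t).2))

section Lin

variable {a b : ℝ}

theorem lin_add (u : ℕ → Bool) (p q : ℝ) (n t : ℕ) :
    lin a b u p q (n + t) =
      lin a b (fun s => u (n + s)) (lin a b u p q n).1 (lin a b u p q n).2 t := by
  induction t with
  | zero => rfl
  | succ t ih =>
    rw [← add_assoc]
    simp only [lin, ih]

theorem lin_congr {u u' : ℕ → Bool} (p q : ℝ) {T : ℕ} (h : ∀ t < T, u t = u' t) :
    ∀ t ≤ T, lin a b u p q t = lin a b u' p q t := by
  intro t
  induction t with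
  | zero => intro _; rfl
  | succ t ih =>
    intro ht
    simp only [lin]
    rw [ih (by omega), h t (by omega)]

theorem lin_mul (u : ℕ → Bool) (s p q : ℝ) (t : ℕ) :
    lin a b u (s * p) (s * q) t = (s * (lin a b u p q t).1, s * (lin a b u p q t).2) := by
  induction t with
  | zero => rfl
  | succ t ih => simp only [lin, ih, Prod.mk.injEq]; constructor <;> ring

theorem lin_sub (u : ℕ → Bool) (p q p' q' : ℝ) (t : ℕ) :
    lin a b u (p - p') (q - q') t = lin a b u p q t - lin a b u p' q' t := by
  induction t with
  | zero => rfl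
  | succ t ih =>
    simp only [lin, ih, Prod.fst_sub, Prod.snd_sub, Prod.ext_iff]
    constructor <;> ring

/-- Every step is linear of determinant one. This gives the exact increment formula `traj_sub_traj`.
-/
theorem lin_det (u : ℕ → Bool) (x y : ℝ) (t : ℕ) :
    (lin a b u y 1 t).1 * (lin a b u x 1 t).2 - (lin a b u x 1 t).1 * (lin a b u y 1 t).2 =
      y - x := by
  induction t with
  | zero => simp [lin]
  | succ t ih =>
    simp only [lin]
    linear_combination ih

/-- Each step adds the denominator to the numerator, so the sum telescopes. An inequality between
numerators thereby becomes one between partial sums of denominators. -/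
theorem sum_lin_snd (u : ℕ → Bool) (p q : ℝ) (T : ℕ) :
    ∑ t ∈ Finset.range T, (lin a b u p q t).2 = (lin a b u p q T).1 - p := by
  induction T with
  | zero => simp [lin]
  | succ T ih => rw [Finset.sum_range_succ, ih, lin]; ring

variable (ha : 0 ≤ a) (hab : a < b)

include ha hab

theorem lin_nonneg (u : ℕ → Bool) {p q : ℝ} (hp : 0 ≤ p) (hq : 0 ≤ q) (t : ℕ) :
    0 ≤ (lin a b u p q t).1 ∧ q ≤ (lin a b u p q t).2 := by
  induction t with
  | zero => exact ⟨hp, le_rfl⟩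
  | succ t ih =>
    have := gain_nonneg ha hab (u t)
    have h2 := hq.trans ih.2
    exact ⟨add_nonneg ih.1 h2, ih.2.trans (le_add_of_nonneg_right
      (mul_nonneg this (add_nonneg ih.1 h2)))⟩

theorem lin_snd_monotone (u : ℕ → Bool) {p q : ℝ} (hp : 0 ≤ p) (hq : 0 ≤ q) :
    Monotone fun t => (lin a b u p q t).2 := by
  refine monotone_nat_of_le_succ fun t => ?_
  obtain ⟨h1, h2⟩ := lin_nonneg ha hab u hp hq t
  exact le_add_of_nonneg_right (mul_nonneg (gain_nonneg ha hab (u t))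
    (add_nonneg h1 (hq.trans h2)))

theorem lin_fst_mono (u : ℕ → Bool) {p p' : ℝ} (h : p ≤ p') (q : ℝ) (t : ℕ) :
    (lin a b u p q t).1 ≤ (lin a b u p' q t).1 := by
  have := (lin_nonneg ha hab u (sub_nonneg.2 h) (sub_self q).ge t).1
  rw [lin_sub] at this
  simpa using this

theorem lin_le_of_imp {u u' : ℕ → Bool} {p q : ℝ} (hp : 0 ≤ p) (hq : 0 ≤ q) {T : ℕ}
    (h : ∀ t < T, u t = true → u' t = true) (t : ℕ) (ht : t ≤ T) :
    (lin a b u p q t).1 ≤ (lin a b u' p q t).1 ∧ (lin a b u p q t).2 ≤ (lin a b u' p q t).2 := by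
  induction t with
  | zero => exact ⟨le_rfl, le_rfl⟩
  | succ t ih =>
    obtain ⟨h1, h2⟩ := ih (by omega)
    obtain ⟨h3, h4⟩ := lin_nonneg ha hab u hp hq t
    have hg : gain a b (u t) ≤ gain a b (u' t) := by
      have := h t (by omega)
      rcases hu : u t with _ | _ <;> rcases hu' : u' t with _ | _ <;> simp_all [gain]
      exact hab.le
    refine ⟨add_le_add h1 h2, add_le_add h2 ?_⟩
    exact mul_le_mul hg (add_le_add h1 h2) (add_nonneg h3 (hq.trans h4)) (gain_nonneg ha hab _)

theorem traj_eq_lin_div (u : ℕ → Bool) {x : ℝ} (hx : 0 ≤ x) (t : ℕ) :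
    traj a b u x t = (lin a b u x 1 t).1 / (lin a b u x 1 t).2 := by
  induction t with
  | zero => simp [traj, lin]
  | succ t ih =>
    have h2 : 0 < (lin a b u x 1 t).2 := one_pos.trans_le (lin_nonneg ha hab u hx zero_le_one t).2
    rw [traj, phi_eq, ih, lin]
    have e : (lin a b u x 1 t).1 / (lin a b u x 1 t).2 + 1 =
      ((lin a b u x 1 t).1 + (lin a b u x 1 t).2) / (lin a b u x 1 t).2 := by field_simp
    rw [e]
    have e2 : gain a b (u t) * (((lin a b u x 1 t).1 + (lin a b u x 1 t).2) /
        (lin a b u x 1 t).2) + 1 = ((lin a b u x 1 t).2 + gain a b (u t) *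
        ((lin a b u x 1 t).1 + (lin a b u x 1 t).2)) / (lin a b u x 1 t).2 := by
      field_simp; ring
    rw [e2, div_div_div_cancel_right₀ h2.ne']

theorem lin_eq_mul_lin_traj (u : ℕ → Bool) {x : ℝ} (hx : 0 ≤ x) (n t : ℕ) :
    (lin a b u x 1 (n + t)).1 = (lin a b u x 1 n).2 *
      (lin a b (fun s => u (n + s)) (traj a b u x n) 1 t).1 := by
  have h2 : 0 < (lin a b u x 1 n).2 := one_pos.trans_le (lin_nonneg ha hab u hx zero_le_one n).2
  rw [lin_add, traj_eq_lin_div ha hab u hx]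
  have := lin_mul (a := a) (b := b) (fun s => u (n + s)) (lin a b u x 1 n).2
    ((lin a b u x 1 n).1 / (lin a b u x 1 n).2) 1 t
  rw [mul_div_cancel₀ _ h2.ne', mul_one] at this
  rw [this]

/-- Along a backward orbit, the linear orbit of `(y 0 + 1, -1)` stays proportional to
`(y t + 1, -1)`. -/
theorem exists_lin_backward {B : ℕ → Bool} {y : ℕ → ℝ} (hy0 : ∀ j, 0 ≤ y j)
    (hy : ∀ j, y j = phi a b (B j) (y (j + 1))) (t : ℕ) :
    ∃ s, 0 < s ∧ lin a b B (y 0 + 1) (-1) t = (s * (y t + 1), -s) := by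
  induction t with
  | zero => exact ⟨1, one_pos, by simp [lin]⟩
  | succ t ih =>
    obtain ⟨s, hs, h⟩ := ih
    have hp := gain_mul_pos ha hab (B t) (hy0 (t + 1))
    -- From `y t = φ (y (t + 1))` one gets `1 - gain * y t = 1 / (gain * (y (t + 1) + 1) + 1)`, the
    -- factor by which `s` shrinks.
    refine ⟨s / (gain a b (B t) * (y (t + 1) + 1) + 1), div_pos hs hp, ?_⟩
    rw [lin, h, hy t, phi_eq]
    ext <;> field_simp <;> ring

/-- After two steps the linear orbits differ by `(b - a) * (x + 1, -1)`, and from then on they are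
driven by the same word. For `x = y 0` the first coordinate of this difference stays positive by
`exists_lin_backward`; a larger `x` only increases it. -/
theorem lin_swap {u u' : ℕ → Bool} (h0 : u 0 = true) (h1 : u 1 = false) (h0' : u' 0 = false)
    (h1' : u' 1 = true) (h : ∀ t, u (t + 2) = u' (t + 2)) {y : ℕ → ℝ} (hy0 : ∀ j, 0 ≤ y j)
    (hy : ∀ j, y j = phi a b (u (j + 2)) (y (j + 1))) {x : ℝ} (hx : y 0 ≤ x) (t : ℕ) :
    (lin a b u' x 1 t).1 ≤ (lin a b u x 1 t).1 := by
  rcases t with _ | _ | t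
  · simp [lin]
  · simp [lin]
  obtain ⟨s, hs, he⟩ := exists_lin_backward ha hab hy0 hy t
  have hpos : 0 ≤ (lin a b (fun s => u (s + 2)) (x + 1) (-1) t).1 := by
    refine le_trans ?_ (lin_fst_mono ha hab _ (add_le_add_left hx 1) (-1) t)
    rw [he]
    exact mul_nonneg hs.le (by linarith [hy0 t])
  have hm := lin_mul (a := a) (b := b) (fun s => u (s + 2)) (b - a) (x + 1) (-1) t
  have e : (fun s => u' (2 + s)) = fun s => u (s + 2) := by
    funext s; rw [add_comm, h]
  have e' : (fun s => u (2 + s)) = fun s => u (s + 2) := by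
    funext s; rw [add_comm]
  rw [show t + 1 + 1 = 2 + t by ring, lin_add u, lin_add u', e, e', ← sub_nonneg, ← Prod.fst_sub,
    ← lin_sub]
  have e1 : (lin a b u x 1 2).1 - (lin a b u' x 1 2).1 = (b - a) * (x + 1) := by
    simp [lin, h0, h0', gain]; ring
  have e2 : (lin a b u x 1 2).2 - (lin a b u' x 1 2).2 = (b - a) * (-1) := by
    simp [lin, h0, h0', h1, h1', gain]; ring
  rw [e1, e2, hm]
  exact mul_nonneg (by linarith) hpos

end Lin

/-! ### Threshold words -/

theorem traj_policyActions (a b : ℝ) (π : ℝ → Bool) (x : ℝ) (t : ℕ) :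
    traj a b (policyActions a b π x) x t = policyTraj a b π x t := by
  induction t with
  | zero => rfl
  | succ t ih => rw [traj, ih, policyTraj, policyActions]

theorem orbit0_eq_traj (a b x : ℝ) (t : ℕ) : orbit0 a b x t = traj a b (action0 a b x) x t :=
  (traj_policyActions a b _ x t).symm

theorem orbit1_eq_traj (a b x : ℝ) (t : ℕ) : orbit1 a b x t = traj a b (action1 a b x) x t :=
  (traj_policyActions a b _ x t).symm

theorem action0_eq_true_iff {a b x : ℝ} (t : ℕ) :
    action0 a b x t = true ↔ x < traj a b (action0 a b x) x t := by
  rw [action0, traj_policyActions]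
  simp [policyActions]

theorem action1_eq_true_iff {a b x : ℝ} (t : ℕ) :
    action1 a b x t = true ↔ x ≤ traj a b (action1 a b x) x t := by
  rw [action1, traj_policyActions]
  simp [policyActions]

theorem action0_zero (a b x : ℝ) : action0 a b x 0 = false := by
  rw [← Bool.not_eq_true, action0_eq_true_iff]; exact lt_irrefl _

theorem action1_zero (a b x : ℝ) : action1 a b x 0 = true :=
  (action1_eq_true_iff 0).2 le_rfl

/-- Up to time `T`, the word `u` is active above `x` and passive below `x` along its own orbit of
`x`; in the state `x` itself either action is allowed. -/
def IsThresholdWord (a b x : ℝ) (u : ℕ → Bool) (T : ℕ) : Prop :=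
  ∀ t < T, (u t = true → x ≤ traj a b u x t) ∧ (u t = false → traj a b u x t ≤ x)

theorem IsThresholdWord.mono {a b x : ℝ} {u : ℕ → Bool} {T T' : ℕ}
    (h : IsThresholdWord a b x u T) (hT : T' ≤ T) : IsThresholdWord a b x u T' :=
  fun t ht => h t (ht.trans_le hT)

theorem isThresholdWord_action0 (a b x : ℝ) (T : ℕ) :
    IsThresholdWord a b x (action0 a b x) T := fun t _ =>
  ⟨fun h => ((action0_eq_true_iff t).1 h).le, fun h => by
    rw [← Bool.not_eq_true, action0_eq_true_iff, not_lt] at h; exact h⟩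

theorem isThresholdWord_action1 (a b x : ℝ) (T : ℕ) :
    IsThresholdWord a b x (action1 a b x) T := fun t _ =>
  ⟨fun h => (action1_eq_true_iff t).1 h, fun h => by
    rw [← Bool.not_eq_true, action1_eq_true_iff, not_le] at h; exact h.le⟩

/-- Two threshold words of `x` agree until the first return to `x`. -/
theorem IsThresholdWord.eq_of_ne {a b x : ℝ} {u u' : ℕ → Bool} {T : ℕ}
    (h : IsThresholdWord a b x u T) (h' : IsThresholdWord a b x u' T) (h0 : u 0 = u' 0)
    (hne : ∀ t, 0 < t → t < T → traj a b u' x t ≠ x) : ∀ t < T, u t = u' t := by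
  intro t
  induction t using Nat.strong_induction_on with
  | _ t ih =>
    intro ht
    rcases t.eq_zero_or_pos with rfl | hpos
    · exact h0
    · have e := traj_congr (a := a) (b := b) x (fun s (hs : s < t) => ih s hs (hs.trans ht)) t le_rfl
      have h1 := h t ht
      have h2 := h' t ht
      have h3 := hne t hpos ht
      rw [e] at h1
      rcases hu : u t with _ | _ <;> rcases hu' : u' t with _ | _
      · rfl
      · exact (h3 (le_antisymm (h1.2 hu) (h2.1 hu'))).elim
      · exact (h3 (le_antisymm (h2.2 hu') (h1.1 hu))).elim
      · rfl

theorem IsThresholdWord.shift {a b x : ℝ} {u : ℕ → Bool} {T n : ℕ}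
    (h : IsThresholdWord a b x u (n + T)) (hn : traj a b u x n = x) :
    IsThresholdWord a b x (fun s => u (n + s)) T := by
  intro t ht
  have := h (n + t) (by omega)
  rwa [traj_add, hn] at this

/-! ### Comparing the numerators of the two threshold words -/

section

variable {a b : ℝ} (ha : 0 ≤ a) (hab : a < b)

include ha hab

/-- If the words of `z` that start like `r` return to `z` at time `n`, while those that start
otherwise follow `v`, then any comparison between `v` and the first period of `r` followed by `v`
extends to all threshold words of `z` that start like `r`. -/
theorem lin_compare_of_return {z σ : ℝ} (hz : 0 ≤ z) {r v : ℕ → Bool} {n : ℕ} (hn : 0 < n)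
    (hret : traj a b r z n = z)
    (hr : ∀ T u, IsThresholdWord a b z u T → u 0 = r 0 → ∀ t < T, t < n → u t = r t)
    (hv : ∀ T u, IsThresholdWord a b z u T → u 0 ≠ r 0 → ∀ t < T, u t = v t)
    (hσ : ∀ x, z ≤ x → ∀ t, 0 ≤ σ * ((lin a b (fun t => if t < n then r t else v (t - n)) x 1 t).1 -
      (lin a b v x 1 t).1))
    (T : ℕ) (u : ℕ → Bool) (hu : IsThresholdWord a b z u T) (hu0 : u 0 = r 0) (x : ℝ)
    (hx : z ≤ x) : 0 ≤ σ * ((lin a b u x 1 T).1 - (lin a b v x 1 T).1) := by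
  induction T using Nat.strong_induction_on generalizing u x with
  | _ T ih =>
    have hur := hr T u hu hu0
    rcases le_or_gt T n with hT | hT
    · have e := lin_congr (a := a) (b := b) (u := u)
        (u' := fun t => if t < n then r t else v (t - n)) x 1
        (fun t (ht : t < T) => by simp only [if_pos (ht.trans_le hT)]; exact hur t ht (by omega))
        T le_rfl
      rw [e]
      exact hσ x hx T
    · obtain ⟨m, rfl⟩ : ∃ m, T = n + m := ⟨T - n, by omega⟩
      have hx0 := hz.trans hx
      have hun : ∀ t < n, u t = r t := fun t ht => hur t (by omega) ht
      have huz : traj a b u z n = z := by rw [traj_congr z hun n le_rfl, hret]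
      have hu' := hu.shift huz
      have hX : z ≤ traj a b u x n := by
        conv_lhs => rw [← huz]
        exact traj_le_traj ha hab u hz hx n
      -- After one period `z` is back at `z`, the orbit of `x` is still at or above `z`, and the
      -- remaining word is again a threshold word of `z`. It is either covered by induction or equal
      -- to `v` as far as it matters.
      have key : 0 ≤ σ * ((lin a b (fun s => u (n + s)) (traj a b u x n) 1 m).1 -
          (lin a b v (traj a b u x n) 1 m).1) := by
        by_cases hc : u n = r 0
        · exact ih m (by omega) _ hu' (by simpa using hc) _ hX
        · have := hv m _ hu' (by simpa using hc)
          rw [lin_congr _ _ this m le_rfl]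
          simp
      have hw := hσ x hx (n + m)
      have hD : 0 ≤ (lin a b u x 1 n).2 :=
        zero_le_one.trans (lin_nonneg ha hab u hx0 zero_le_one n).2
      have e1 : (lin a b (fun t => if t < n then r t else v (t - n)) x 1 (n + m)).1 =
          (lin a b u x 1 n).2 * (lin a b v (traj a b u x n) 1 m).1 := by
        rw [lin_eq_mul_lin_traj ha hab _ hx0]
        have h1 : ∀ t < n, (fun t => if t < n then r t else v (t - n)) t = u t := by
          intro t ht; simp [ht, hun t ht]
        rw [lin_congr _ _ h1 n le_rfl, traj_congr _ h1 n le_rfl]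
        congr 3
        funext s
        simp
      rw [e1] at hw
      rw [lin_eq_mul_lin_traj ha hab u hx0]
      have := mul_nonneg hD key
      linarith

/-- The comparison of the two kinds of threshold words of a state that returns to itself. -/
theorem lin_le_of_return {z : ℝ} (hz : 0 ≤ z) {u u' : ℕ → Bool} {T : ℕ}
    (hu : IsThresholdWord a b z u T) (hu' : IsThresholdWord a b z u' T) (hu0 : u 0 = true)
    (hu0' : u' 0 = false)
    (htie : ∃ t, 0 < t ∧ t < T ∧ (traj a b u z t = z ∨ traj a b u' z t = z)) {x : ℝ}
    (hx : z ≤ x) : (lin a b u' x 1 T).1 ≤ (lin a b u x 1 T).1 := by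
  classical
  have hT : 0 < T := by obtain ⟨t, h, h', -⟩ := htie; omega
  have first : ∀ w ρ : ℕ → Bool, IsThresholdWord a b z w T →
      (∀ N, IsThresholdWord a b z ρ N) → w 0 = ρ 0 →
      (∃ t, 0 < t ∧ t < T ∧ traj a b w z t = z) →
      ∃ n, 0 < n ∧ traj a b ρ z n = z ∧ ∀ t, 0 < t → t < n → traj a b ρ z t ≠ z := by
    intro w ρ hw hρ h0 ⟨t, ht0, htT, ht⟩
    by_cases h : ∃ n, 0 < n ∧ traj a b ρ z n = z
    · refine ⟨Nat.find h, (Nat.find_spec h).1, (Nat.find_spec h).2, fun t h1 h2 h3 => ?_⟩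
      exact Nat.find_min h h2 ⟨h1, h3⟩
    · push Not at h
      have := hw.eq_of_ne (hρ T) h0 fun t h1 _ => h t h1
      exact (h t ht0 (by rw [← traj_congr z (fun s hs => this s (hs.trans htT)) t le_rfl, ht])).elim
  have hw1 := isThresholdWord_action1 a b z
  have hw0 := isThresholdWord_action0 a b z
  obtain ⟨t, ht0, htT, ht | ht⟩ := htie
  · obtain ⟨n, hn, hret, hmin⟩ := first u _ hu hw1 (hu0.trans (action1_zero a b z).symm)
      ⟨t, ht0, htT, ht⟩
    obtain ⟨⟨y, hy0, hyn, hy⟩, h0, h1, hcat, hne⟩ := traj_return_words ha hab hz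
      action1_eq_true_iff action0_eq_true_iff hn hret hmin
    have hvv : ∀ T u, IsThresholdWord a b z u T → u 0 ≠ action1 a b z 0 →
        ∀ t < T, u t = action0 a b z t := fun T u h h0' =>
      h.eq_of_ne (hw0 T) (by rw [action1_zero] at h0'; rw [h0]; simpa using h0')
        fun t ht _ => hne t ht
    have := lin_compare_of_return (σ := 1) ha hab hz hn hret (v := action0 a b z)
      (fun T u h h0' t htT htn => (h.mono (min_le_left T n)).eq_of_ne (hw1 _) h0'
        (fun t ht ht' => hmin t ht (by omega)) t (by omega)) hvv (fun x hx t => by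
        rw [one_mul, sub_nonneg]
        refine lin_swap ha hab (y := y) (by rw [hcat]; simp) (by rw [hcat]; simp) h0 h1
          (fun t => by simp [hcat]) hyn (fun j => ?_) (by rw [hy0]; exact hx) t
        rw [hcat]; simpa using hy j) T u hu (hu0.trans (action1_zero a b z).symm) x hx
    rw [lin_congr x 1 (hvv T u' hu' (by rw [hu0', action1_zero]; simp)) T le_rfl]
    linarith
  · obtain ⟨n, hn, hret, hmin⟩ := first u' _ hu' hw0 (hu0'.trans (action0_zero a b z).symm)
      ⟨t, ht0, htT, ht⟩
    obtain ⟨⟨y, hy0, hyn, hy⟩, h0, h1, hcat, hne⟩ := traj_return_words_dual ha hab hz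
      action0_eq_true_iff action1_eq_true_iff hn hret hmin
    have hvv : ∀ T u, IsThresholdWord a b z u T → u 0 ≠ action0 a b z 0 →
        ∀ t < T, u t = action1 a b z t := fun T u h h0' =>
      h.eq_of_ne (hw1 T) (by rw [action0_zero] at h0'; rw [h0]; simpa using h0')
        fun t ht _ => hne t ht
    have := lin_compare_of_return (σ := -1) ha hab hz hn hret (v := action1 a b z)
      (fun T u h h0' t htT htn => (h.mono (min_le_left T n)).eq_of_ne (hw0 _) h0'
        (fun t ht ht' => hmin t ht (by omega)) t (by omega)) hvv (fun x hx t => by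
        have : (lin a b (fun t => if t < n then action0 a b z t else action1 a b z (t - n)) x 1 t).1
            ≤ (lin a b (action1 a b z) x 1 t).1 :=
          lin_swap ha hab (y := y) h0 h1 (by rw [hcat]; simp) (by rw [hcat]; simp)
            (fun t => by simp [hcat]) hyn hy (by rw [hy0]; exact hx) t
        linarith) T u' hu' (hu0'.trans (action0_zero a b z).symm) x hx
    rw [lin_congr x 1 (hvv T u hu (by rw [hu0, action0_zero]; simp)) T le_rfl]
    linarith

theorem continuousOn_phi (c : Bool) : ContinuousOn (phi a b c) (Ici 0) := by
  have : phi a b c = fun x => (x + 1) / (gain a b c * (x + 1) + 1) := funext (phi_eq a b c)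
  rw [this]
  exact ContinuousOn.div (by fun_prop) (by fun_prop) fun x hx => (gain_mul_pos ha hab c hx).ne'

theorem continuousOn_traj (u : ℕ → Bool) (t : ℕ) :
    ContinuousOn (fun x => traj a b u x t) (Ici 0) := by
  induction t with
  | zero => exact continuousOn_id
  | succ t ih =>
    exact (continuousOn_phi ha hab (u t)).comp ih fun x hx => traj_nonneg ha hab u hx t

theorem action0_fst_le_action1_fst {x : ℝ} (hx : 0 ≤ x) (T : ℕ) :
    (lin a b (action0 a b x) x 1 T).1 ≤ (lin a b (action1 a b x) x 1 T).1 := by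
  set u := action1 a b x with hu
  set u' := action0 a b x with hu'
  -- The words of `x` stay fixed while the threshold moves down: `Ω` collects the `z` for which both
  -- are still threshold words. It is closed and bounded below, so its infimum belongs to it.
  set Ω := {z : ℝ | z ∈ Icc 0 x ∧ IsThresholdWord a b z u T ∧ IsThresholdWord a b z u' T} with hΩ
  have hxΩ : x ∈ Ω :=
    ⟨⟨hx, le_rfl⟩, isThresholdWord_action1 a b x T, isThresholdWord_action0 a b x T⟩
  have hclosed : ∀ w : ℕ → Bool, IsClosed {z : ℝ | z ∈ Icc 0 x ∧ IsThresholdWord a b z w T} := by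
    intro w
    have e : {z : ℝ | z ∈ Icc 0 x ∧ IsThresholdWord a b z w T} = Icc 0 x ∩ ⋂ t : ℕ, ⋂ _ : t < T,
        ({z | z ∈ Icc 0 x ∧ 0 ≤ (if w t then traj a b w z t - z else z - traj a b w z t)}) := by
      ext z
      simp only [IsThresholdWord, mem_ofPred_eq, mem_inter_iff, mem_iInter]
      refine and_congr_right fun hz => forall₂_congr fun t _ => ?_
      rcases w t <;> simp [hz.1, hz.2]
    rw [e]
    refine isClosed_Icc.inter (isClosed_iInter fun t => isClosed_iInter fun _ => ?_)
    have hc : ContinuousOn (fun z => if w t then traj a b w z t - z else z - traj a b w z t)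
        (Icc 0 x) := by
      have := (continuousOn_traj ha hab w t).mono (t := Icc 0 x) (fun z hz => hz.1)
      rcases w t
      · simp only [Bool.false_eq_true, if_false]; exact continuousOn_id.sub this
      · simp only [if_true]; exact this.sub continuousOn_id
    exact hc.preimage_isClosed_of_isClosed isClosed_Icc isClosed_Ici
  have hΩc : IsClosed Ω := by
    have : Ω = {z : ℝ | z ∈ Icc 0 x ∧ IsThresholdWord a b z u T} ∩
        {z : ℝ | z ∈ Icc 0 x ∧ IsThresholdWord a b z u' T} := by
      ext z; simp only [hΩ, mem_ofPred_eq, mem_inter_iff]; tauto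
    rw [this]
    exact (hclosed u).inter (hclosed u')
  have hbdd : BddBelow Ω := ⟨0, fun z hz => hz.1.1⟩
  set z := sInf Ω with hz
  have hzΩ : z ∈ Ω := hΩc.csInf_mem ⟨x, hxΩ⟩ hbdd
  obtain ⟨⟨hz0, hzx⟩, hwu, hwu'⟩ := hzΩ
  have hu0 : u 0 = true := action1_zero a b x
  have hu0' : u' 0 = false := action0_zero a b x
  by_cases htie : ∃ t, 0 < t ∧ t < T ∧ (traj a b u z t = z ∨ traj a b u' z t = z)
  · exact lin_le_of_return ha hab hz0 hwu hwu' hu0 hu0' htie hzx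
  push Not at htie
  rcases hz0.eq_or_lt with h0 | hpos
  -- At threshold zero all later states are positive, hence `u` is active at every time before `T`.
  · refine (lin_le_of_imp ha hab hx zero_le_one (fun t ht _ => ?_) T le_rfl).1
    rcases t.eq_zero_or_pos with rfl | htpos
    · exact hu0
    · obtain ⟨s, rfl⟩ : ∃ s, t = s + 1 := ⟨t - 1, by omega⟩
      by_contra h
      have h1 := (hwu _ ht).2 (by simpa using h)
      rw [← h0] at h1
      exact h1.not_gt (phi_pos ha hab _ (traj_nonneg ha hab u le_rfl s))
  -- Without a return, all threshold conditions after time zero are strict. They persist for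
  -- slightly smaller `z`, contradicting minimality.
  · exfalso
    have hev : ∀ w : ℕ → Bool, IsThresholdWord a b z w T →
        (∀ t, 0 < t → t < T → traj a b w z t ≠ z) →
        ∀ᶠ y in nhds z, IsThresholdWord a b y w T := by
      intro w hw hne
      have : ∀ t ∈ Finset.range T, ∀ᶠ y in nhds z,
          (w t = true → y ≤ traj a b w y t) ∧ (w t = false → traj a b w y t ≤ y) := by
        intro t ht
        rw [Finset.mem_range] at ht
        rcases t.eq_zero_or_pos with rfl | htpos
        · exact Filter.Eventually.of_forall fun y => ⟨fun _ => le_rfl, fun _ => le_rfl⟩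
        have hc : ContinuousAt (fun y => traj a b w y t) z :=
          (continuousOn_traj ha hab w t).continuousAt (Ici_mem_nhds hpos)
        rcases lt_or_gt_of_ne (hne t htpos ht) with h | h
        · have hwt : w t = false := by
            by_contra h'
            exact h.not_ge ((hw t ht).1 (by simpa using h'))
          filter_upwards [hc.eventually_lt continuousAt_id h] with y hy
          exact ⟨fun h' => by simp [hwt] at h', fun _ => hy.le⟩
        · have hwt : w t = true := by
            by_contra h'
            exact h.not_ge ((hw t ht).2 (by simpa using h'))
          filter_upwards [continuousAt_id.eventually_lt hc h] with y hy
          exact ⟨fun _ => hy.le, fun h' => by simp [hwt] at h'⟩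
      filter_upwards [(Filter.eventually_all_finset _).2 this] with y hy t ht
      exact hy t (Finset.mem_range.2 ht)
    have h1 := hev u hwu fun t h1 h2 => (htie t h1 h2).1
    have h2 := hev u' hwu' fun t h1 h2 => (htie t h1 h2).2
    have h3 : ∀ᶠ y in nhdsWithin z (Iio z), y ∈ Ω := by
      filter_upwards [nhdsWithin_le_nhds h1, nhdsWithin_le_nhds h2,
        nhdsWithin_le_nhds (lt_mem_nhds hpos), self_mem_nhdsWithin] with y h1 h2 h3 h4
      exact ⟨⟨h3.le, (le_of_lt h4).trans hzx⟩, h1, h2⟩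
    obtain ⟨y, hyΩ, hyz⟩ := (h3.and self_mem_nhdsWithin).exists
    exact (csInf_le hbdd hyΩ).not_gt hyz

end

/-! ### Discounted sums -/

/-- The discounted number of active times of the word `u`. -/
def usage (β : ℝ) (u : ℕ → Bool) : ℝ := ∑' t : ℕ, β ^ t * actVal (u t)

/-- The discounted sum of the error variances from `x` under the word `u`. -/
def hold (a b β : ℝ) (u : ℕ → Bool) (x : ℝ) : ℝ := ∑' t : ℕ, β ^ t * traj a b u x t

theorem actVal_nonneg (c : Bool) : 0 ≤ actVal c := by cases c <;> simp [actVal]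

theorem actVal_le_one (c : Bool) : actVal c ≤ 1 := by cases c <;> simp [actVal]

theorem actVal_eq_toNat (c : Bool) : actVal c = (c.toNat : ℝ) := by cases c <;> simp [actVal]

section Sums

variable {β : ℝ} (hβ0 : 0 < β) (hβ1 : β < 1)

include hβ0 hβ1

theorem summable_usage (u : ℕ → Bool) : Summable fun t : ℕ => β ^ t * actVal (u t) :=
  Summable.of_nonneg_of_le (fun t => mul_nonneg (pow_nonneg hβ0.le t) (actVal_nonneg _))
    (fun t => mul_le_of_le_one_right (pow_nonneg hβ0.le t) (actVal_le_one _))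
    (summable_geometric_of_lt_one hβ0.le hβ1)

omit hβ1 in
theorem usage_nonneg (u : ℕ → Bool) : 0 ≤ usage β u :=
  tsum_nonneg fun t => mul_nonneg (pow_nonneg hβ0.le t) (actVal_nonneg _)

theorem usage_le (u : ℕ → Bool) : usage β u ≤ 1 / (1 - β) := by
  rw [one_div, ← tsum_geometric_of_lt_one hβ0.le hβ1]
  exact (summable_usage hβ0 hβ1 u).tsum_le_tsum
    (fun t => mul_le_of_le_one_right (pow_nonneg hβ0.le t) (actVal_le_one _))
    (summable_geometric_of_lt_one hβ0.le hβ1)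

theorem summable_pow_mul_add (x : ℝ) : Summable fun t : ℕ => β ^ t * (x + t) := by
  have h1 := (summable_geometric_of_lt_one hβ0.le hβ1).mul_right x
  have h2 := summable_pow_mul_geometric_of_norm_lt_one 1
    (show ‖β‖ < 1 by rwa [Real.norm_of_nonneg hβ0.le])
  refine (h1.add h2).congr fun t => ?_
  simp; ring

/-- By Abel summation the difference is `(1 - β) * ∑ β ^ t * (count u (t + 1) - count u' (t + 1))`;
all terms are nonnegative and the term at `t = 0` contributes `1 - β`. -/
theorem one_sub_le_usage_sub {u u' : ℕ → Bool} (h : ∀ t, count u' t ≤ count u t)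
    (hu0 : u 0 = true) (hu0' : u' 0 = false) : 1 - β ≤ usage β u - usage β u' := by
  rw [usage, usage, ← (summable_usage hβ0 hβ1 u).tsum_sub (summable_usage hβ0 hβ1 u')]
  have hs := ((summable_usage hβ0 hβ1 u).sub (summable_usage hβ0 hβ1 u')).hasSum.tendsto_sum_nat
  refine ge_of_tendsto (hs.comp (Filter.tendsto_add_atTop_nat 1)) (Filter.Eventually.of_forall
    fun T => ?_)
  have hnn : ∀ T, (0 : ℝ) ≤ (count u T : ℝ) - count u' T := fun T => by
    have : (count u' T : ℝ) ≤ count u T := by exact_mod_cast h T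
    linarith
  have key : 1 - β + β ^ (T + 1) * ((count u (T + 1) : ℝ) - count u' (T + 1)) ≤
      ∑ t ∈ Finset.range (T + 1), (β ^ t * actVal (u t) - β ^ t * actVal (u' t)) := by
    induction T with
    | zero => simp [count, hu0, hu0', actVal]
    | succ T ih =>
      rw [Finset.sum_range_succ, count_succ u (T + 1), count_succ u' (T + 1)]
      rw [actVal_eq_toNat, actVal_eq_toNat]
      have h2 := hnn (T + 1 + 1)
      rw [count_succ u (T + 1), count_succ u' (T + 1)] at h2
      have hp : β ^ (T + 1 + 1) ≤ β ^ (T + 1) :=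
        pow_le_pow_of_le_one hβ0.le hβ1.le (Nat.le_succ _)
      push_cast at h2 ⊢
      nlinarith [mul_le_mul_of_nonneg_right hp h2]
  have := mul_nonneg (pow_nonneg hβ0.le (T + 1)) (hnn (T + 1))
  simp only [Function.comp]
  linarith

variable {a b : ℝ} (ha : 0 ≤ a) (hab : a < b)

include ha hab

theorem summable_hold (u : ℕ → Bool) {x : ℝ} (hx : 0 ≤ x) :
    Summable fun t : ℕ => β ^ t * traj a b u x t :=
  Summable.of_nonneg_of_le
    (fun t => mul_nonneg (pow_nonneg hβ0.le t) (traj_nonneg ha hab u hx t))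
    (fun t => mul_le_mul_of_nonneg_left (traj_le_add ha hab u hx t) (pow_nonneg hβ0.le t))
    (summable_pow_mul_add hβ0 hβ1 x)

omit hβ1 in
theorem hold_nonneg (u : ℕ → Bool) {x : ℝ} (hx : 0 ≤ x) : 0 ≤ hold a b β u x :=
  tsum_nonneg fun t => mul_nonneg (pow_nonneg hβ0.le t) (traj_nonneg ha hab u hx t)

theorem cost_eq (w h ν : ℝ) (u : ℕ → Bool) {x : ℝ} (hx : 0 ≤ x) :
    cost a b w h β ν u x = (h + ν) * usage β u + w * hold a b β u x := by
  rw [usage, hold, ← tsum_mul_left, ← tsum_mul_left,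
    ← ((summable_usage hβ0 hβ1 u).mul_left _).tsum_add
      ((summable_hold hβ0 hβ1 ha hab u hx).mul_left _), cost]
  exact tsum_congr fun t => by ring

-- Suppose the word of `x` keeps the orbit of `y` above the one driven by the word of `y`. When the
-- latter is active its state is at least `y`; as the maps are nonexpansive, the orbit of `x` is
-- then at least `x`, so the word of `x` is active too.
omit hβ0 hβ1 in
theorem count_action1_antitone {x y : ℝ} (hx : 0 ≤ x) (hxy : x ≤ y) (t : ℕ) :
    count (action1 a b y) t ≤ count (action1 a b x) t :=
  count_le_count_of_traj ha hab (fun t h ht => (action1_eq_true_iff t).2 <| by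
    have h1 := h y (hx.trans hxy)
    have h2 := traj_sub_le ha hab (action1 a b x) hx hxy t
    have h3 := (action1_eq_true_iff t).1 ht
    linarith) t

omit hβ0 hβ1 in
theorem count_action0_antitone {x y : ℝ} (hx : 0 ≤ x) (hxy : x ≤ y) (t : ℕ) :
    count (action0 a b y) t ≤ count (action0 a b x) t :=
  count_le_count_of_traj ha hab (fun t h ht => (action0_eq_true_iff t).2 <| by
    have h1 := h y (hx.trans hxy)
    have h2 := traj_sub_le ha hab (action0 a b x) hx hxy t
    have h3 := (action0_eq_true_iff t).1 ht
    linarith) t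

omit hβ0 hβ1 in
theorem count_action0_le_count_action1 {x : ℝ} (hx : 0 ≤ x) (t : ℕ) :
    count (action0 a b x) t ≤ count (action1 a b x) t :=
  count_le_count_of_traj ha hab (fun t h ht => (action1_eq_true_iff t).2 <|
    ((action0_eq_true_iff t).1 ht).le.trans (h x hx)) t

/-- The denominator of the index formula. -/
theorem one_sub_le_usage_action {x : ℝ} (hx : 0 ≤ x) :
    1 - β ≤ usage β (action1 a b x) - usage β (action0 a b x) :=
  one_sub_le_usage_sub hβ0 hβ1 (count_action0_le_count_action1 ha hab hx) (action1_zero a b x)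
    (action0_zero a b x)

theorem whittleFormula_eq (w h : ℝ) {x : ℝ} (hx : 0 ≤ x) :
    whittleFormula a b w h β x = w * ((hold a b β (action0 a b x) x -
      hold a b β (action1 a b x) x) / (usage β (action1 a b x) - usage β (action0 a b x))) - h := by
  have h0 := summable_hold hβ0 hβ1 ha hab (action0 a b x) hx
  have h1 := summable_hold hβ0 hβ1 ha hab (action1 a b x) hx
  have e1 : ∑' t : ℕ, β ^ t * (actVal (action1 a b x t) - actVal (action0 a b x t)) =
      usage β (action1 a b x) - usage β (action0 a b x) := by
    rw [usage, usage, ← (summable_usage hβ0 hβ1 _).tsum_sub (summable_usage hβ0 hβ1 _)]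
    exact tsum_congr fun t => by ring
  have e2 : ∑' t : ℕ, β ^ (t + 1) * (orbit0 a b x (t + 1) - orbit1 a b x (t + 1)) =
      hold a b β (action0 a b x) x - hold a b β (action1 a b x) x := by
    rw [hold, hold, ← h0.tsum_sub h1, (h0.sub h1).tsum_eq_zero_add]
    simp only [traj, sub_self, zero_add]
    exact tsum_congr fun t => by rw [orbit0_eq_traj, orbit1_eq_traj]; simp only [traj]; ring
  rw [whittleFormula, e1, e2]

/-- The index is the added cost at which the two threshold words are equally good. -/
theorem cost_action_eq_iff (w h ν : ℝ) {x : ℝ} (hx : 0 ≤ x) :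
    cost a b w h β ν (action0 a b x) x = cost a b w h β ν (action1 a b x) x ↔
      ν = whittleFormula a b w h β x := by
  have hD := one_sub_le_usage_action hβ0 hβ1 ha hab hx
  rw [whittleFormula_eq hβ0 hβ1 ha hab w h hx, cost_eq hβ0 hβ1 ha hab _ _ _ _ hx,
    cost_eq hβ0 hβ1 ha hab _ _ _ _ hx, eq_sub_iff_add_eq, ← mul_div_assoc,
    eq_div_iff (by linarith)]
  constructor <;> intro h <;> linarith

/-! ### Monotonicity on sets where the words agree -/

omit ha hab in
omit hβ0 hβ1 in
theorem sum_mul_nonneg_of_antitone {c δ : ℕ → ℝ} (hc0 : ∀ t, 0 ≤ c t) (hc : Antitone c)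
    (hδ : ∀ T, 0 ≤ ∑ t ∈ Finset.range T, δ t) (T : ℕ) :
    0 ≤ ∑ t ∈ Finset.range T, c t * δ t := by
  suffices H : c T * ∑ t ∈ Finset.range T, δ t ≤ ∑ t ∈ Finset.range T, c t * δ t from
    (mul_nonneg (hc0 T) (hδ T)).trans H
  induction T with
  | zero => simp
  | succ T ih =>
    have h1 : c (T + 1) * ∑ t ∈ Finset.range (T + 1), δ t ≤
        c T * ∑ t ∈ Finset.range (T + 1), δ t :=
      mul_le_mul_of_nonneg_right (hc (Nat.le_succ T)) (hδ _)
    refine h1.trans ?_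
    rw [Finset.sum_range_succ, Finset.sum_range_succ, mul_add]
    linarith

omit hβ0 hβ1 in
theorem sum_lin_sub_nonneg {x : ℝ} (hx : 0 ≤ x) (T : ℕ) :
    0 ≤ ∑ t ∈ Finset.range T, ((lin a b (action1 a b x) x 1 t).2 -
      (lin a b (action0 a b x) x 1 t).2) := by
  rw [Finset.sum_sub_distrib, sum_lin_snd, sum_lin_snd]
  linarith [action0_fst_le_action1_fst ha hab hx T]

omit hβ0 hβ1 in
theorem traj_sub_traj (u : ℕ → Bool) {x y : ℝ} (hx : 0 ≤ x) (hy : 0 ≤ y) (t : ℕ) :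
    traj a b u y t - traj a b u x t =
      (y - x) * (1 / ((lin a b u x 1 t).2 * (lin a b u y 1 t).2)) := by
  have h1 : 0 < (lin a b u x 1 t).2 := one_pos.trans_le (lin_nonneg ha hab u hx zero_le_one t).2
  have h2 : 0 < (lin a b u y 1 t).2 := one_pos.trans_le (lin_nonneg ha hab u hy zero_le_one t).2
  rw [traj_eq_lin_div ha hab u hx, traj_eq_lin_div ha hab u hy, ← lin_det (a := a) (b := b) u x y t]
  field_simp

omit hβ0 hβ1 ha hab in
theorem three_mul_le {p q : ℝ} (hp : 0 ≤ p) (hq : 0 ≤ q) :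
    3 * (p * q) ≤ 1 + p * q * (p + q) := by
  rcases le_or_gt 3 (p + q) with h | h
  · nlinarith [mul_nonneg hp hq]
  · have h1 : p * q ≤ ((p + q) / 2) ^ 2 := by nlinarith [sq_nonneg (p - q)]
    nlinarith [mul_le_mul_of_nonneg_right h1 (sub_nonneg.2 h.le),
      mul_nonneg (sq_nonneg ((p + q) / 2 - 1)) (add_nonneg zero_le_one (add_nonneg hp hq))]

-- Convexity of `1 / (p * q)` on the positive quadrant: the graph lies above its tangent plane at
-- `(P, R)`. In the ratios `p / P` and `q / R` this is `three_mul_le`, the AM-GM inequality for `1`,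
-- `p²q`, `pq²`.
omit hβ0 hβ1 ha hab in
theorem inv_mul_sub_ge {p q P R : ℝ} (hp : 0 < p) (hq : 0 < q) (hP : 0 < P) (hR : 0 < R) :
    1 / (P ^ 2 * R) * (P - p) + 1 / (P * R ^ 2) * (R - q) ≤ 1 / (p * q) - 1 / (P * R) := by
  have e : 1 / (p * q) - 1 / (P * R) - (1 / (P ^ 2 * R) * (P - p) + 1 / (P * R ^ 2) * (R - q)) =
      (P ^ 2 * R ^ 2 - 3 * (P * R * p * q) + p ^ 2 * q * R + p * q ^ 2 * P) /
        (P ^ 2 * R ^ 2 * p * q) := by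
    field_simp
    ring
  have hnum : 0 ≤ P ^ 2 * R ^ 2 - 3 * (P * R * p * q) + p ^ 2 * q * R + p * q ^ 2 * P := by
    have h1 := three_mul_le (div_pos hp hP).le (div_pos hq hR).le
    have h2 := mul_le_mul_of_nonneg_left h1 (mul_pos (pow_pos hP 2) (pow_pos hR 2)).le
    have e1 : P ^ 2 * R ^ 2 * (3 * (p / P * (q / R))) = 3 * (P * R * p * q) := by field_simp
    have e2 : P ^ 2 * R ^ 2 * (1 + p / P * (q / R) * (p / P + q / R)) =
        P ^ 2 * R ^ 2 + p ^ 2 * q * R + p * q ^ 2 * P := by field_simp; ring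
    linarith
  have : 0 ≤ 1 / (p * q) - 1 / (P * R) -
      (1 / (P ^ 2 * R) * (P - p) + 1 / (P * R ^ 2) * (R - q)) := by
    rw [e]; positivity
  linarith

/-- If `x ≤ y` have the same threshold words up to time `T`, then the truncated numerator of the
index formula at `y` is at least the one at `x`. -/
theorem sum_traj_sub_mono {x y : ℝ} (hx : 0 ≤ x) (hxy : x ≤ y) {T : ℕ}
    (h0 : ∀ t < T, action0 a b x t = action0 a b y t)
    (h1 : ∀ t < T, action1 a b x t = action1 a b y t) :
    ∑ t ∈ Finset.range (T + 1), β ^ t * (traj a b (action0 a b x) x t -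
      traj a b (action1 a b x) x t) ≤
    ∑ t ∈ Finset.range (T + 1), β ^ t * (traj a b (action0 a b y) y t -
      traj a b (action1 a b y) y t) := by
  have hy := hx.trans hxy
  have hpos : ∀ u z, 0 ≤ z → ∀ t, 0 < (lin a b u z 1 t).2 := fun u z hz t =>
    one_pos.trans_le (lin_nonneg ha hab u hz zero_le_one t).2
  have hmon : ∀ u z, 0 ≤ z → Monotone fun t => (lin a b u z 1 t).2 := fun u z hz =>
    lin_snd_monotone ha hab u hz zero_le_one
  set P := fun t => (lin a b (action1 a b x) x 1 t).2 with hP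
  set R := fun t => (lin a b (action1 a b y) y 1 t).2 with hR
  set p := fun t => (lin a b (action0 a b x) x 1 t).2 with hp
  set q := fun t => (lin a b (action0 a b y) y 1 t).2 with hq
  have hP0 : ∀ t, 0 < P t := hpos _ x hx
  have hR0 : ∀ t, 0 < R t := hpos _ y hy
  have hPm : Monotone P := hmon _ x hx
  have hRm : Monotone R := hmon _ y hy
  have hβm : Antitone fun t : ℕ => β ^ t := fun s t hst =>
    pow_le_pow_of_le_one hβ0.le hβ1.le hst
  have hc : ∀ i j : ℕ, Antitone fun t => β ^ t * (1 / (P t ^ i * R t ^ j)) := by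
    intro i j s t hst
    have h1 : P s ^ i * R s ^ j ≤ P t ^ i * R t ^ j :=
      mul_le_mul (pow_le_pow_left₀ (hP0 s).le (hPm hst) i)
        (pow_le_pow_left₀ (hR0 s).le (hRm hst) j) (pow_pos (hR0 s) j).le (pow_pos (hP0 t) i).le
    have h2 := mul_pos (pow_pos (hP0 s) i) (pow_pos (hR0 s) j)
    exact mul_le_mul (hβm hst) (one_div_le_one_div_of_le h2 h1)
      (one_div_nonneg.2 (h2.trans_le h1).le) (pow_nonneg hβ0.le s)
  have hc0 : ∀ i j t : ℕ, 0 ≤ β ^ t * (1 / (P t ^ i * R t ^ j)) := fun i j t =>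
    mul_nonneg (pow_nonneg hβ0.le t)
      (one_div_nonneg.2 (mul_pos (pow_pos (hP0 t) i) (pow_pos (hR0 t) j)).le)
  have s1 := sum_mul_nonneg_of_antitone (hc0 2 1) (hc 2 1)
    (fun T => sum_lin_sub_nonneg ha hab hx T) (T + 1)
  have s2 := sum_mul_nonneg_of_antitone (hc0 1 2) (hc 1 2)
    (fun T => sum_lin_sub_nonneg ha hab hy T) (T + 1)
  -- As the words agree, `traj_sub_traj` expresses the increments through denominators, and the
  -- tangent plane bound makes them linear in `P - p` and `R - q`, with weights decreasing in time.
  -- Time `T` is included because the state then depends only on the first `T` actions.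
  have key : ∀ t ∈ Finset.range (T + 1), (y - x) * (β ^ t * (1 / (P t ^ 2 * R t ^ 1)) *
        (P t - p t) + β ^ t * (1 / (P t ^ 1 * R t ^ 2)) * (R t - q t)) ≤
      β ^ t * (traj a b (action0 a b y) y t - traj a b (action1 a b y) y t) -
      β ^ t * (traj a b (action0 a b x) x t - traj a b (action1 a b x) x t) := by
    intro t ht
    have ht' : t ≤ T := by rw [Finset.mem_range] at ht; omega
    have e0 := traj_sub_traj ha hab (action0 a b y) hx hy t
    have e1 := traj_sub_traj ha hab (action1 a b y) hx hy t
    rw [← traj_congr x h0 t ht', ← lin_congr x 1 h0 t ht'] at e0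
    rw [← traj_congr x h1 t ht', ← lin_congr x 1 h1 t ht'] at e1
    have hi := inv_mul_sub_ge (hpos (action0 a b x) x hx t) (hpos (action0 a b y) y hy t)
      (hP0 t) (hR0 t)
    have hi2 := mul_le_mul_of_nonneg_left hi
      (mul_nonneg (sub_nonneg.2 hxy) (pow_nonneg hβ0.le t))
    rw [pow_one, pow_one]
    calc _ = (y - x) * β ^ t * (1 / (P t ^ 2 * R t) * (P t - p t) +
          1 / (P t * R t ^ 2) * (R t - q t)) := by ring
      _ ≤ _ := hi2
      _ = β ^ t * ((y - x) * (1 / (p t * q t)) - (y - x) * (1 / (P t * R t))) := by ring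
      _ = _ := by rw [← e0, ← e1]; ring
  have hs := Finset.sum_le_sum key
  rw [← Finset.mul_sum, Finset.sum_add_distrib, Finset.sum_sub_distrib] at hs
  have := mul_nonneg (sub_nonneg.2 hxy) (add_nonneg s1 s2)
  linarith

end Sums

/-! ### Continuity of the index -/

open Filter Topology

theorem policyActions_add (a b : ℝ) (π : ℝ → Bool) (x : ℝ) (n : ℕ) :
    (fun t => policyActions a b π x (n + t)) = policyActions a b π (policyTraj a b π x n) := by
  have h : ∀ t, policyTraj a b π x (n + t) = policyTraj a b π (policyTraj a b π x n) t := by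
    intro t
    induction t with
    | zero => rfl
    | succ t ih => rw [← add_assoc, policyTraj, ih, policyTraj]
  funext t
  rw [policyActions, h, policyActions]

/-! ### Costs and limits of threshold words -/

section

variable {a b β : ℝ} (ha : 0 ≤ a) (hab : a < b) (hβ0 : 0 < β) (hβ1 : β < 1)

include ha hab hβ0 hβ1

theorem summable_cost (w h ν : ℝ) (u : ℕ → Bool) {x : ℝ} (hx : 0 ≤ x) :
    Summable fun t : ℕ => β ^ t * ((h + ν) * actVal (u t) + w * traj a b u x t) := by
  refine (((summable_usage hβ0 hβ1 u).mul_left (h + ν)).add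
    ((summable_hold hβ0 hβ1 ha hab u hx).mul_left w)).congr fun t => ?_
  ring

theorem cost_split (w h ν : ℝ) (u : ℕ → Bool) {x : ℝ} (hx : 0 ≤ x) (n : ℕ) :
    cost a b w h β ν u x =
      ∑ t ∈ Finset.range n, β ^ t * ((h + ν) * actVal (u t) + w * traj a b u x t) +
        β ^ n * cost a b w h β ν (fun t => u (n + t)) (traj a b u x n) := by
  rw [cost, ← (summable_cost ha hab hβ0 hβ1 w h ν u hx).sum_add_tsum_nat_add n, cost,
    ← tsum_mul_left]
  congr 1
  refine tsum_congr fun t => ?_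
  rw [add_comm t n, traj_add, pow_add]
  ring

theorem cost_congr_add (w h ν : ℝ) {u u' : ℕ → Bool} {x : ℝ} (hx : 0 ≤ x) {n : ℕ}
    (hu : ∀ t < n, u t = u' t) :
    cost a b w h β ν u x - cost a b w h β ν u' x =
      β ^ n * (cost a b w h β ν (fun t => u (n + t)) (traj a b u' x n) -
        cost a b w h β ν (fun t => u' (n + t)) (traj a b u' x n)) := by
  rw [cost_split ha hab hβ0 hβ1 w h ν u hx n, cost_split ha hab hβ0 hβ1 w h ν u' hx n,
    traj_congr x hu n le_rfl]
  have : ∑ t ∈ Finset.range n, β ^ t * ((h + ν) * actVal (u t) + w * traj a b u x t) =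
      ∑ t ∈ Finset.range n, β ^ t * ((h + ν) * actVal (u' t) + w * traj a b u' x t) :=
    Finset.sum_congr rfl fun t ht => by
      rw [Finset.mem_range] at ht
      rw [hu t ht, traj_congr x hu t ht.le]
  rw [this]
  ring

theorem hold_le (u : ℕ → Bool) {x : ℝ} (hx : 0 ≤ x) :
    hold a b β u x ≤ ∑' t : ℕ, β ^ t * (x + t) :=
  (summable_hold hβ0 hβ1 ha hab u hx).tsum_le_tsum
    (fun t => mul_le_mul_of_nonneg_left (traj_le_add ha hab u hx t) (pow_nonneg hβ0.le t))
    (summable_pow_mul_add hβ0 hβ1 x)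

theorem abs_cost_le (w h ν : ℝ) (u : ℕ → Bool) {x : ℝ} (hx : 0 ≤ x) :
    |cost a b w h β ν u x| ≤
      |h + ν| * (1 / (1 - β)) + |w| * ∑' t : ℕ, β ^ t * (x + t) := by
  rw [cost_eq hβ0 hβ1 ha hab w h ν u hx]
  refine (abs_add_le _ _).trans ?_
  rw [abs_mul, abs_mul, abs_of_nonneg (usage_nonneg hβ0 u),
    abs_of_nonneg (hold_nonneg hβ0 ha hab u hx)]
  exact add_le_add (mul_le_mul_of_nonneg_left (usage_le hβ0 hβ1 u) (abs_nonneg _))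
    (mul_le_mul_of_nonneg_left (hold_le ha hab hβ0 hβ1 u hx) (abs_nonneg _))

/-- At the added cost given by the index, all threshold words of `x` are equally good, whatever
they do in the state `x`. -/
theorem cost_eq_of_isThresholdWord (w h : ℝ) {x : ℝ} (hx : 0 ≤ x) {u : ℕ → Bool}
    (hu : ∀ T, IsThresholdWord a b x u T) :
    cost a b w h β (whittleFormula a b w h β x) u x =
      cost a b w h β (whittleFormula a b w h β x) (action0 a b x) x := by
  set ν := whittleFormula a b w h β x with hν
  set J := cost a b w h β ν (action0 a b x) x with hJ
  have hJ1 : J = cost a b w h β ν (action1 a b x) x :=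
    (cost_action_eq_iff hβ0 hβ1 ha hab w h ν hx).2 hν
  set C := |h + ν| * (1 / (1 - β)) + |w| * ∑' t : ℕ, β ^ t * (x + t) with hC
  have hbound : ∀ u, |cost a b w h β ν u x| ≤ C := fun u =>
    abs_cost_le ha hab hβ0 hβ1 w h ν u hx
  have hC0 : 0 ≤ C := (abs_nonneg _).trans (hbound u)
  -- Up to its first return to `x`, `u` agrees with the canonical word that has the same first
  -- action, and both canonical words cost `J`. What remains after the return is again a threshold
  -- word of `x`, so each return gains a factor of at most `β`.
  have key : ∀ (k : ℕ) (u : ℕ → Bool), (∀ T, IsThresholdWord a b x u T) →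
      |cost a b w h β ν u x - J| ≤ 2 * C * β ^ k := by
    intro k
    induction k with
    | zero =>
      intro u _
      have h1 := hbound u
      have h2 := hbound (action0 a b x)
      rw [abs_le] at h1 h2 ⊢
      constructor <;> linarith
    | succ k ih =>
      intro u hu
      obtain ⟨ρ, hρ, h0, hρJ, hper⟩ : ∃ ρ : ℕ → Bool, (∀ T, IsThresholdWord a b x ρ T) ∧
          u 0 = ρ 0 ∧ cost a b w h β ν ρ x = J ∧
          ∀ n, traj a b ρ x n = x → (fun t => ρ (n + t)) = ρ := by
        rcases hu0 : u 0 with _ | _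
        · refine ⟨action0 a b x, isThresholdWord_action0 a b x, (action0_zero a b x).symm, rfl,
            fun n hn => ?_⟩
          rw [action0, traj_policyActions] at hn
          rw [action0, policyActions_add, hn]
        · refine ⟨action1 a b x, isThresholdWord_action1 a b x, (action1_zero a b x).symm,
            hJ1.symm, fun n hn => ?_⟩
          rw [action1, traj_policyActions] at hn
          rw [action1, policyActions_add, hn]
      by_cases hex : ∃ n, 0 < n ∧ traj a b ρ x n = x
      · classical
        obtain ⟨hn0, hn⟩ := Nat.find_spec hex
        set n := Nat.find hex with hndef
        have heq := (hu n).eq_of_ne (hρ n) h0 fun t h1 h2 h3 => Nat.find_min hex h2 ⟨h1, h3⟩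
        have e := cost_congr_add ha hab hβ0 hβ1 w h ν hx heq
        rw [hn, hper n hn, hρJ] at e
        rw [e, abs_mul, abs_of_nonneg (pow_nonneg hβ0.le n)]
        have h1 := ih _ fun T =>
          (hu (n + T)).shift (by rw [traj_congr x heq n le_rfl, hn])
        have h2 : β ^ n ≤ β ^ 1 := pow_le_pow_of_le_one hβ0.le hβ1.le hn0
        calc _ ≤ β ^ 1 * (2 * C * β ^ k) :=
              mul_le_mul h2 h1 (abs_nonneg _) (pow_nonneg hβ0.le _)
          _ = 2 * C * β ^ (k + 1) := by ring
      · push Not at hex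
        have : u = ρ := funext fun t =>
          (hu (t + 1)).eq_of_ne (hρ (t + 1)) h0 (fun t h1 _ => hex t h1) t (Nat.lt_succ_self t)
        rw [this, hρJ, sub_self, abs_zero]
        positivity
  have hlim : Tendsto (fun k : ℕ => 2 * C * β ^ k) atTop (𝓝 (2 * C * 0)) :=
    (tendsto_pow_atTop_nhds_zero_of_lt_one hβ0.le hβ1).const_mul _
  have := ge_of_tendsto' hlim fun k => key k u hu
  rw [mul_zero] at this
  exact sub_eq_zero.1 (abs_nonpos_iff.1 this)

theorem whittleFormula_eq_of_isThresholdWord (w h : ℝ) {x : ℝ} (hx : 0 ≤ x) {u u' : ℕ → Bool}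
    (hu : ∀ T, IsThresholdWord a b x u T) (hu' : ∀ T, IsThresholdWord a b x u' T)
    (hpos : 0 < usage β u - usage β u') :
    whittleFormula a b w h β x =
      w * ((hold a b β u' x - hold a b β u x) / (usage β u - usage β u')) - h := by
  have h1 := cost_eq_of_isThresholdWord ha hab hβ0 hβ1 w h hx hu
  have h2 := cost_eq_of_isThresholdWord ha hab hβ0 hβ1 w h hx hu'
  rw [← h2, cost_eq hβ0 hβ1 ha hab _ _ _ _ hx, cost_eq hβ0 hβ1 ha hab _ _ _ _ hx] at h1
  rw [eq_sub_iff_add_eq, ← mul_div_assoc, eq_div_iff hpos.ne']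
  linarith

omit hβ0 hβ1 in
theorem tendsto_traj {U : ℕ → ℕ → Bool} {u : ℕ → Bool} {y : ℕ → ℝ} {x : ℝ} (hx : 0 ≤ x)
    (hy : ∀ n, 0 ≤ y n) (hU : Tendsto U atTop (𝓝 u)) (hyx : Tendsto y atTop (𝓝 x)) (t : ℕ) :
    Tendsto (fun n => traj a b (U n) (y n) t) atTop (𝓝 (traj a b u x t)) := by
  induction t with
  | zero => exact hyx
  | succ t ih =>
    have h1 : ∀ᶠ n in atTop, U n t = u t := by
      have := (tendsto_pi_nhds.1 hU) t
      rw [nhds_discrete, tendsto_pure] at this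
      exact this
    have h2 : Tendsto (fun n => phi a b (u t) (traj a b (U n) (y n) t)) atTop
        (𝓝 (phi a b (u t) (traj a b u x t))) := by
      have hc := continuousOn_phi ha hab (u t) _ (traj_nonneg ha hab u hx t)
      exact hc.tendsto.comp (tendsto_nhdsWithin_iff.2
        ⟨ih, Eventually.of_forall fun n => traj_nonneg ha hab (U n) (hy n) t⟩)
    refine h2.congr' ?_
    filter_upwards [h1] with n hn
    rw [traj, hn]

omit hβ0 hβ1 in
theorem isThresholdWord_of_tendsto {U : ℕ → ℕ → Bool} {u : ℕ → Bool} {y : ℕ → ℝ} {x : ℝ}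
    (hx : 0 ≤ x) (hy : ∀ n, 0 ≤ y n) (hU : Tendsto U atTop (𝓝 u)) (hyx : Tendsto y atTop (𝓝 x))
    (h : ∀ n T, IsThresholdWord a b (y n) (U n) T) (T : ℕ) : IsThresholdWord a b x u T := by
  intro t _
  have h1 : ∀ᶠ n in atTop, U n t = u t := by
    have := (tendsto_pi_nhds.1 hU) t
    rw [nhds_discrete, tendsto_pure] at this
    exact this
  have h2 := tendsto_traj ha hab hx hy hU hyx t
  constructor
  · intro hut
    refine le_of_tendsto_of_tendsto hyx h2 ?_
    filter_upwards [h1] with n hn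
    exact (h n (t + 1) t (Nat.lt_succ_self t)).1 (hn.trans hut)
  · intro hut
    refine le_of_tendsto_of_tendsto h2 hyx ?_
    filter_upwards [h1] with n hn
    exact (h n (t + 1) t (Nat.lt_succ_self t)).2 (hn.trans hut)

omit ha hab in
theorem tendsto_usage {U : ℕ → ℕ → Bool} {u : ℕ → Bool} (hU : Tendsto U atTop (𝓝 u)) :
    Tendsto (fun n => usage β (U n)) atTop (𝓝 (usage β u)) := by
  refine tendsto_tsum_of_dominated_convergence (bound := fun t : ℕ => β ^ t)
    (summable_geometric_of_lt_one hβ0.le hβ1) (fun t => ?_) (Eventually.of_forall fun n t => ?_)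
  · have := (tendsto_pi_nhds.1 hU) t
    rw [nhds_discrete, tendsto_pure] at this
    refine tendsto_const_nhds.congr' ?_
    filter_upwards [this] with n hn
    rw [hn]
  · rw [Real.norm_of_nonneg (mul_nonneg (pow_nonneg hβ0.le t) (actVal_nonneg _))]
    exact mul_le_of_le_one_right (pow_nonneg hβ0.le t) (actVal_le_one _)

theorem tendsto_hold {U : ℕ → ℕ → Bool} {u : ℕ → Bool} {y : ℕ → ℝ} {x : ℝ}
    (hx : 0 ≤ x) (hy : ∀ n, 0 ≤ y n) (hU : Tendsto U atTop (𝓝 u))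
    (hyx : Tendsto y atTop (𝓝 x)) :
    Tendsto (fun n => hold a b β (U n) (y n)) atTop (𝓝 (hold a b β u x)) := by
  refine tendsto_tsum_of_dominated_convergence (bound := fun t : ℕ => β ^ t * ((x + 1) + t))
    (summable_pow_mul_add hβ0 hβ1 (x + 1)) (fun t => ?_) ?_
  · exact (tendsto_traj ha hab hx hy hU hyx t).const_mul _
  · filter_upwards [hyx.eventually_le_const (lt_add_one x)] with n hn t
    rw [Real.norm_of_nonneg
      (mul_nonneg (pow_nonneg hβ0.le t) (traj_nonneg ha hab (U n) (hy n) t))]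
    refine mul_le_mul_of_nonneg_left ?_ (pow_nonneg hβ0.le t)
    linarith [traj_le_add ha hab (U n) (hy n) t]

theorem continuousOn_whittleFormula (w h : ℝ) :
    ContinuousOn (whittleFormula a b w h β) (Ici 0) := by
  intro x hx
  refine tendsto_of_seq_tendsto fun y hy => ?_
  obtain ⟨hyx, hy0⟩ := tendsto_nhdsWithin_iff.1 hy
  refine tendsto_of_subseq_tendsto fun ns hns => ?_
  have hevt : ∀ᶠ n in atTop, 0 ≤ y (ns n) := hns.eventually hy0
  obtain ⟨N, hN⟩ := eventually_atTop.1 hevt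
  -- Pairs of words form a compact space. The limit words are threshold words of `x`, possibly
  -- different from `action1` and `action0` of `x`.
  obtain ⟨⟨u, u'⟩, -, ms, hms, hlim⟩ := isCompact_univ.tendsto_subseq
    (x := fun n => ((action1 a b (y (ns (n + N))), action0 a b (y (ns (n + N)))) :
      (ℕ → Bool) × (ℕ → Bool))) (fun n => mem_univ _)
  refine ⟨fun n => ms n + N, ?_⟩
  have hz0 : ∀ n, 0 ≤ y (ns (ms n + N)) := fun n => hN _ (Nat.le_add_left _ _)
  have hz : Tendsto (fun n => y (ns (ms n + N))) atTop (𝓝 x) :=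
    hyx.comp (hns.comp ((tendsto_add_atTop_nat N).comp hms.tendsto_atTop))
  have hU : Tendsto (fun n => action1 a b (y (ns (ms n + N)))) atTop (𝓝 u) :=
    (continuous_fst.tendsto _).comp hlim
  have hU' : Tendsto (fun n => action0 a b (y (ns (ms n + N)))) atTop (𝓝 u') :=
    (continuous_snd.tendsto _).comp hlim
  have hD := (tendsto_usage hβ0 hβ1 hU).sub (tendsto_usage hβ0 hβ1 hU')
  have hpos : 0 < usage β u - usage β u' := lt_of_lt_of_le (sub_pos.2 hβ1) <|
    ge_of_tendsto' hD fun n => one_sub_le_usage_action hβ0 hβ1 ha hab (hz0 n)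
  have hH := (tendsto_hold ha hab hβ0 hβ1 hx hz0 hU' hz).sub
    (tendsto_hold ha hab hβ0 hβ1 hx hz0 hU hz)
  rw [whittleFormula_eq_of_isThresholdWord ha hab hβ0 hβ1 w h hx
    (isThresholdWord_of_tendsto ha hab hx hz0 hU hz fun n => isThresholdWord_action1 a b _)
    (isThresholdWord_of_tendsto ha hab hx hz0 hU' hz fun n => isThresholdWord_action0 a b _) hpos]
  refine Tendsto.congr (fun n => ?_) (((hH.div hD hpos.ne').const_mul w).sub_const h)
  exact (whittleFormula_eq hβ0 hβ1 ha hab w h (hz0 n)).symm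

end

/-! ### Monotonicity of the index -/

/-- A continuous function that loses at most `ε` on each set where the antitone integer-valued
function `P` is constant loses at most `k + 1` times `ε` while `P` drops by `k`. -/
theorem sub_le_of_antitone_nat {g : ℝ → ℝ} {P : ℝ → ℕ} {A : ℝ} (hg : ContinuousOn g (Ici A))
    (hP : AntitoneOn P (Ici A)) {M ε : ℝ} (hε : 0 ≤ ε)
    (hstep : ∀ x y, A ≤ x → x ≤ y → y ≤ M → P x = P y → g x - ε ≤ g y) (k : ℕ) :
    ∀ x y, A ≤ x → x ≤ y → y ≤ M → P x ≤ P y + k → g x - (k + 1) * ε ≤ g y := by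
  induction k with
  | zero =>
    intro x y hx hxy hy h
    have := hstep x y hx hxy hy (le_antisymm h (hP hx (hx.trans hxy) hxy))
    simpa using this
  | succ k ih =>
    intro x y hx hxy hy h
    have hgI : ContinuousOn g (Icc x y) := hg.mono fun z hz => hx.trans hz.1
    -- Up to the supremum `z` of the level set of `x` at most `ε` is lost. Beyond `z` the value of
    -- `P` has dropped, so the induction hypothesis applies there, and continuity extends its bound
    -- to `z`.
    set S := {t | t ∈ Icc x y ∧ P t = P x} with hS
    have hxS : x ∈ S := ⟨⟨le_rfl, hxy⟩, rfl⟩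
    have hbdd : BddAbove S := ⟨y, fun t ht => ht.1.2⟩
    have hz := csSup_mem_closure ⟨x, hxS⟩ hbdd
    set z := sSup S
    have hsub1 : S ⊆ Icc x y ∩ g ⁻¹' Ici (g x - ε) := fun t ht =>
      ⟨ht.1, hstep x t hx ht.1.1 (ht.1.2.trans hy) ht.2.symm⟩
    have hz1 : z ∈ Icc x y ∩ g ⁻¹' Ici (g x - ε) :=
      closure_minimal hsub1 (hgI.preimage_isClosed_of_isClosed isClosed_Icc isClosed_Ici) hz
    have hgz : g x - ε ≤ g z := hz1.2
    rcases hz1.1.2.eq_or_lt with hzy | hzy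
    · rw [hzy] at hgz
      have : 0 ≤ ((k + 1 : ℕ) : ℝ) * ε := by positivity
      linarith
    · have hsub2 : Ioc z y ⊆ Icc x y ∩ g ⁻¹' Iic (g y + (k + 1) * ε) := by
        intro t ht
        have hxt := hz1.1.1.trans ht.1.le
        have hne : P t ≠ P x := fun h => (le_csSup hbdd ⟨⟨hxt, ht.2⟩, h⟩).not_gt ht.1
        have hle := hP hx (hx.trans hxt) hxt
        have := ih t y (hx.trans hxt) ht.2 hy (by omega)
        refine ⟨⟨hxt, ht.2⟩, ?_⟩
        simp only [mem_preimage, mem_Iic]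
        linarith
      have hz2 : z ∈ Icc x y ∩ g ⁻¹' Iic (g y + (k + 1) * ε) :=
        closure_minimal hsub2 (hgI.preimage_isClosed_of_isClosed isClosed_Icc isClosed_Iic)
          (by rw [closure_Ioc hzy.ne]; exact ⟨le_rfl, hzy.le⟩)
      have : g z ≤ g y + (k + 1) * ε := hz2.2
      push_cast
      linarith

theorem abs_tsum_sub_sum_le {β : ℝ} (hβ0 : 0 < β) (hβ1 : β < 1) {f : ℕ → ℝ} {B : ℝ}
    (hf : ∀ t, |f t| ≤ B) (n : ℕ) :
    |(∑' t : ℕ, β ^ t * f t) - ∑ t ∈ Finset.range n, β ^ t * f t| ≤ B / (1 - β) * β ^ n := by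
  have hgeo := hasSum_geometric_of_lt_one hβ0.le hβ1
  have hb : ∀ t, ‖β ^ t * f t‖ ≤ B * β ^ t := fun t => by
    rw [Real.norm_eq_abs, abs_mul, abs_of_nonneg (pow_nonneg hβ0.le t), mul_comm]
    exact mul_le_mul_of_nonneg_right (hf t) (pow_nonneg hβ0.le t)
  have hs : Summable fun t : ℕ => β ^ t * f t :=
    Summable.of_norm_bounded (hgeo.summable.mul_left B) hb
  rw [← hs.sum_add_tsum_nat_add n, add_sub_cancel_left, ← Real.norm_eq_abs]
  have h2 : HasSum (fun t : ℕ => B * β ^ (t + n)) (B / (1 - β) * β ^ n) := by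
    have := hgeo.mul_left (B * β ^ n)
    rw [show B / (1 - β) * β ^ n = B * β ^ n * (1 - β)⁻¹ by ring]
    refine this.congr_fun fun t => ?_
    simp only [pow_add]; ring
  exact tsum_of_norm_bounded h2 fun t => hb (t + n)

theorem count_le (u : ℕ → Bool) (t : ℕ) : count u t ≤ t := by
  induction t with
  | zero => simp [count]
  | succ t ih =>
    rw [count_succ]
    have := Bool.toNat_le (u t)
    omega

/-! ### Level sets on which the words agree -/

section

variable {a b β : ℝ} (ha : 0 ≤ a) (hab : a < b)

include ha hab

/-- A passive step starts at or below `x` and adds at most one; an active step lands below `1 / b`.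
Unlike `traj_le_add` this is uniform in time, as geometric tail estimates require. -/
theorem IsThresholdWord.traj_le {x : ℝ} (hx : 0 ≤ x) {u : ℕ → Bool}
    (hu : ∀ T, IsThresholdWord a b x u T) (t : ℕ) : traj a b u x t ≤ x + 1 + 1 / b := by
  have hb : 0 ≤ 1 / b := one_div_nonneg.2 (ha.trans hab.le)
  rcases t with _ | t
  · simp only [traj]; linarith
  have h0 := traj_nonneg ha hab u hx t
  rw [traj]
  rcases hut : u t with _ | _
  · have h1 := (hu (t + 1) t (Nat.lt_succ_self t)).2 hut
    have h2 := phi_le_add_one ha hab false h0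
    linarith
  · have := phi_true_lt_inv ha hab h0
    linarith

/-- The total number of activations, over all prefixes of length at most `T` of both threshold
words of `x`. -/
def countSum (a b : ℝ) (T : ℕ) (x : ℝ) : ℕ :=
  ∑ t ∈ Finset.range (T + 1), (count (action1 a b x) t + count (action0 a b x) t)

theorem countSum_antitoneOn (T : ℕ) : AntitoneOn (countSum a b T) (Ici 0) :=
  fun _ hx _ _ hxy => Finset.sum_le_sum fun t _ =>
    add_le_add (count_action1_antitone ha hab hx hxy t) (count_action0_antitone ha hab hx hxy t)

-- A bound polynomial in `T` is what lets a loss of order `β ^ T` per level vanish in total.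
omit ha hab in
theorem countSum_le (T : ℕ) (x : ℝ) : countSum a b T x ≤ 2 * (T + 1) ^ 2 := by
  have : countSum a b T x ≤ ∑ t ∈ Finset.range (T + 1), (2 * (T + 1)) :=
    Finset.sum_le_sum fun t ht => by
      have h1 := count_le (action1 a b x) t
      have h2 := count_le (action0 a b x) t
      rw [Finset.mem_range] at ht
      omega
  rw [Finset.sum_const, Finset.card_range, smul_eq_mul] at this
  linarith

/-- Each summand is antitone in the state, so equal sums force equal counts at every time, and the
increments of the counts are the actions. -/
theorem actions_eq_of_countSum_eq {x y : ℝ} (hx : 0 ≤ x) (hxy : x ≤ y) {T : ℕ}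
    (h : countSum a b T x = countSum a b T y) :
    (∀ t < T, action0 a b x t = action0 a b y t) ∧ ∀ t < T, action1 a b x t = action1 a b y t := by
  have h1 := count_action1_antitone ha hab hx hxy
  have h0 := count_action0_antitone ha hab hx hxy
  have key := (Finset.sum_eq_sum_iff_of_le (s := Finset.range (T + 1))
    fun t _ => add_le_add (h1 t) (h0 t)).1 h.symm
  have hc : ∀ t ≤ T, count (action1 a b y) t = count (action1 a b x) t ∧
      count (action0 a b y) t = count (action0 a b x) t := fun t ht => by
    have h2 := key t (Finset.mem_range.2 (by omega))
    have h3 := h1 t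
    have h4 := h0 t
    omega
  have inj : ∀ c c' : Bool, c.toNat = c'.toNat → c = c' := by decide
  refine ⟨fun t ht => inj _ _ ?_, fun t ht => inj _ _ ?_⟩
  · have h2 := (hc t ht.le).2
    have h3 := (hc (t + 1) ht).2
    rw [count_succ, count_succ] at h3
    omega
  · have h2 := (hc t ht.le).1
    have h3 := (hc (t + 1) ht).1
    rw [count_succ, count_succ] at h3
    omega

variable (hβ0 : 0 < β) (hβ1 : β < 1)

include hβ0 hβ1

theorem exists_whittleFormula_step {w : ℝ} (hw : 0 ≤ w) (h M : ℝ) (hM : 0 ≤ M) :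
    ∃ K, 0 ≤ K ∧ ∀ T x y, 0 ≤ x → x ≤ y → y ≤ M → countSum a b T x = countSum a b T y →
      whittleFormula a b w h β x - K * β ^ T ≤ whittleFormula a b w h β y := by
  set δ := 1 - β with hδ
  have hδ0 : 0 < δ := sub_pos.2 hβ1
  have hb : 0 < b := ha.trans_lt hab
  set c := (M + 1 + 1 / b) / δ with hc
  have hc0 : 0 ≤ c := by positivity
  -- The first term comes from a numerator loss of at most `2 * c * β ^ T` over a denominator at
  -- least `δ`. The second comes from a denominator change of at most `2 / δ * β ^ T`, times `|N x|
  -- ≤ c`, over a product of denominators at least `δ * δ`.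
  refine ⟨w * (2 * c / δ + c * (2 / δ) / (δ * δ)), by positivity, fun T x y hx hxy hy hxyT => ?_⟩
  obtain ⟨e0, e1⟩ := actions_eq_of_countSum_eq ha hab hx hxy hxyT
  have hy0 := hx.trans hxy
  have hβT := pow_nonneg hβ0.le T
  set N := fun z => hold a b β (action0 a b z) z - hold a b β (action1 a b z) z with hN
  set D := fun z => usage β (action1 a b z) - usage β (action0 a b z) with hD
  have hNsum : ∀ z, 0 ≤ z → N z = ∑' t : ℕ, β ^ t * (traj a b (action0 a b z) z t -
      traj a b (action1 a b z) z t) := fun z hz => by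
    rw [hN]
    simp only [hold]
    rw [← (summable_hold hβ0 hβ1 ha hab _ hz).tsum_sub (summable_hold hβ0 hβ1 ha hab _ hz)]
    exact tsum_congr fun t => by ring
  have hDsum : ∀ z, D z = ∑' t : ℕ, β ^ t * (actVal (action1 a b z t) -
      actVal (action0 a b z t)) := fun z => by
    rw [hD]
    simp only [usage]
    rw [← (summable_usage hβ0 hβ1 _).tsum_sub (summable_usage hβ0 hβ1 _)]
    exact tsum_congr fun t => by ring
  have hNb : ∀ z, 0 ≤ z → z ≤ M → ∀ t, |traj a b (action0 a b z) z t -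
      traj a b (action1 a b z) z t| ≤ M + 1 + 1 / b := fun z hz hzM t => by
    have h1 := IsThresholdWord.traj_le ha hab hz (isThresholdWord_action1 a b z) t
    have h2 := IsThresholdWord.traj_le ha hab hz (isThresholdWord_action0 a b z) t
    have h3 := traj_nonneg ha hab (action1 a b z) hz t
    have h4 := traj_nonneg ha hab (action0 a b z) hz t
    rw [abs_le]
    constructor <;> linarith
  have hDb : ∀ z t, |actVal (action1 a b z t) - actVal (action0 a b z t)| ≤ 1 := fun z t => by
    have h1 := actVal_le_one (action1 a b z t)
    have h2 := actVal_le_one (action0 a b z t)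
    have h3 := actVal_nonneg (action1 a b z t)
    have h4 := actVal_nonneg (action0 a b z t)
    rw [abs_le]
    constructor <;> linarith
  have hNx := abs_tsum_sub_sum_le hβ0 hβ1 (hNb x hx (hxy.trans hy)) (T + 1)
  have hNy := abs_tsum_sub_sum_le hβ0 hβ1 (hNb y hy0 hy) (T + 1)
  have hNx0 := abs_tsum_sub_sum_le hβ0 hβ1 (hNb x hx (hxy.trans hy)) 0
  have hDx := abs_tsum_sub_sum_le hβ0 hβ1 (hDb x) T
  have hDy := abs_tsum_sub_sum_le hβ0 hβ1 (hDb y) T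
  rw [← hNsum x hx] at hNx hNx0
  rw [← hNsum y hy0] at hNy
  rw [← hDsum] at hDx hDy
  rw [← hc, ← hδ] at *
  have hDeq : ∑ t ∈ Finset.range T, β ^ t * (actVal (action1 a b x t) - actVal (action0 a b x t)) =
      ∑ t ∈ Finset.range T, β ^ t * (actVal (action1 a b y t) - actVal (action0 a b y t)) :=
    Finset.sum_congr rfl fun t ht => by
      rw [Finset.mem_range] at ht
      rw [e0 t ht, e1 t ht]
  have hmono := sum_traj_sub_mono hβ0 hβ1 ha hab hx hxy e0 e1
  have hpow : c * β ^ (T + 1) ≤ c * β ^ T :=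
    mul_le_mul_of_nonneg_left (pow_le_pow_of_le_one hβ0.le hβ1.le (Nat.le_succ T)) hc0
  have hNN : N x - 2 * c * β ^ T ≤ N y := by
    rw [abs_le] at hNx hNy
    linarith [hNx.1, hNx.2, hNy.1, hNy.2]
  have hDD : |D x - D y| ≤ 2 / δ * β ^ T := by
    rw [hDeq] at hDx
    rw [abs_le] at hDx hDy ⊢
    have : 2 / δ * β ^ T = 1 / δ * β ^ T + 1 / δ * β ^ T := by ring
    constructor <;> linarith [hDx.1, hDx.2, hDy.1, hDy.2]
  have hNxc : |N x| ≤ c := by simpa using hNx0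
  have hDxδ : δ ≤ D x := one_sub_le_usage_action hβ0 hβ1 ha hab hx
  have hDyδ : δ ≤ D y := one_sub_le_usage_action hβ0 hβ1 ha hab hy0
  have hDx0 := hδ0.trans_le hDxδ
  have hDy0 := hδ0.trans_le hDyδ
  rw [whittleFormula_eq hβ0 hβ1 ha hab w h hx, whittleFormula_eq hβ0 hβ1 ha hab w h hy0]
  change w * (N x / D x) - h - _ ≤ w * (N y / D y) - h
  have hdiff : N y / D y - N x / D x =
      (N y - N x) / D y + N x * (D x - D y) / (D x * D y) := by
    field_simp
    ring
  have h1 : -(2 * c / δ * β ^ T) ≤ (N y - N x) / D y := by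
    rw [le_div_iff₀ hDy0]
    have h3 : 2 * c * β ^ T ≤ 2 * c / δ * β ^ T * D y := by
      rw [show 2 * c / δ * β ^ T * D y = 2 * c * β ^ T * (D y / δ) by ring]
      exact le_mul_of_one_le_right (by positivity) ((one_le_div hδ0).2 hDyδ)
    linarith
  have h2 : -(c * (2 / δ) / (δ * δ) * β ^ T) ≤ N x * (D x - D y) / (D x * D y) := by
    have h4 : |N x * (D x - D y) / (D x * D y)| ≤ c * (2 / δ) / (δ * δ) * β ^ T := by
      rw [abs_div, abs_mul, abs_of_pos (mul_pos hDx0 hDy0)]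
      calc _ ≤ c * (2 / δ * β ^ T) / (δ * δ) := by gcongr
        _ = _ := by ring
    exact (abs_le.1 h4).1
  have h5 : -((2 * c / δ + c * (2 / δ) / (δ * δ)) * β ^ T) ≤ N y / D y - N x / D x := by
    rw [hdiff]; linarith
  have := mul_le_mul_of_nonneg_left h5 hw
  linarith

theorem monotoneOn_whittleFormula {w : ℝ} (hw : 0 ≤ w) (h : ℝ) :
    MonotoneOn (whittleFormula a b w h β) (Ici 0) := by
  intro x hx y hy hxy
  obtain ⟨K, hK, hstep⟩ := exists_whittleFormula_step ha hab hβ0 hβ1 hw h y hy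
  have key : ∀ T : ℕ, whittleFormula a b w h β x - ((2 * ((T : ℝ) + 1) ^ 2) + 1) * (K * β ^ T) ≤
      whittleFormula a b w h β y := by
    intro T
    have := sub_le_of_antitone_nat (continuousOn_whittleFormula ha hab hβ0 hβ1 w h)
      (countSum_antitoneOn ha hab T) (mul_nonneg hK (pow_nonneg hβ0.le T)) (M := y)
      (fun x' y' => hstep T x' y') (2 * (T + 1) ^ 2) x y hx hxy le_rfl
      ((countSum_le T x).trans (Nat.le_add_left _ _))
    push_cast at this
    exact this
  have habs : |β| < 1 := by rwa [abs_of_pos hβ0]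
  have hp := fun k : ℕ => tendsto_pow_const_mul_const_pow_of_abs_lt_one k habs
  have hlim : Tendsto (fun T : ℕ => whittleFormula a b w h β x -
      ((2 * ((T : ℝ) + 1) ^ 2) + 1) * (K * β ^ T)) atTop (𝓝 (whittleFormula a b w h β x)) := by
    have h1 := (((hp 2).const_mul (2 * K)).add ((hp 1).const_mul (4 * K))).add
      ((hp 0).const_mul (3 * K))
    have h2 := tendsto_const_nhds (x := whittleFormula a b w h β x) (f := atTop (α := ℕ)).sub h1
    simp only [mul_zero, add_zero, sub_zero] at h2
    refine h2.congr fun T => ?_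
    ring
  exact le_of_tendsto' hlim key

end

/-! ### The single-arm problem -/

/-- The word that starts with `c` and continues with `u`. -/
def consWord (c : Bool) (u : ℕ → Bool) : ℕ → Bool
  | 0 => c
  | t + 1 => u t

theorem traj_consWord (a b : ℝ) (c : Bool) (u : ℕ → Bool) (x : ℝ) (t : ℕ) :
    traj a b (consWord c u) x (t + 1) = traj a b u (phi a b c x) t := by
  induction t with
  | zero => rfl
  | succ t ih => rw [traj, ih, traj]; rfl

/-! ### Slopes from supergradients -/

section Supergradient

variable {q F : ℝ → ℝ} {K : ℝ} (hq : ∀ μ ν, q μ ≤ q ν + (μ - ν) * F ν) (hF0 : ∀ ν, 0 ≤ F ν)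
  (hFK : ∀ ν, F ν ≤ K)

include hq hF0 hFK

theorem continuous_of_supergradient : Continuous q := by
  have hK : 0 ≤ K := (hF0 0).trans (hFK 0)
  have key : ∀ μ ν, q μ - q ν ≤ K * |μ - ν| := fun μ ν => by
    have h1 : (μ - ν) * F ν ≤ |μ - ν| * K :=
      mul_le_mul (le_abs_self _) (hFK ν) (hF0 ν) (abs_nonneg _)
    linarith [hq μ ν]
  refine LipschitzWith.continuous (K := K.toNNReal) (LipschitzWith.of_dist_le_mul fun μ ν => ?_)
  rw [Real.dist_eq, Real.dist_eq, Real.coe_toNNReal _ hK, abs_le]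
  have h1 := key μ ν
  have h2 := key ν μ
  rw [abs_sub_comm] at h2
  constructor <;> linarith

/-- If the supergradients of `q` exceed those of `q'` by at least `c`, then `q - q'` has slope at
least `c`. -/
theorem mul_sub_le_of_supergradient {q' F' : ℝ → ℝ} {c : ℝ}
    (hq' : ∀ μ ν, q' μ ≤ q' ν + (μ - ν) * F' ν) (hc : ∀ ν, c ≤ F ν - F' ν) {μ ν : ℝ}
    (hμν : μ ≤ ν) : c * (ν - μ) ≤ (q ν - q' ν) - (q μ - q' μ) := by
  -- On each of `N + 1` steps of length `δ`, `q` gains at least `δ * F` at the right end and `q'` at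
  -- most `δ * F'` at the left end. Replacing `F` at the right end by `F` at the left end costs a
  -- telescoping error of at most `δ * K` in all.
  have key : ∀ N : ℕ, c * (ν - μ) - K * (ν - μ) * (1 / ((N : ℝ) + 1)) ≤
      (q ν - q' ν) - (q μ - q' μ) := by
    intro N
    set δ := (ν - μ) / ((N : ℝ) + 1) with hδ
    have hN : (0 : ℝ) < (N : ℝ) + 1 := by positivity
    have hδ0 : 0 ≤ δ := div_nonneg (sub_nonneg.2 hμν) hN.le
    have hstep : ∀ i : ℕ, i * δ * c + δ * (F (μ + i * δ) - F μ) ≤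
        (q (μ + i * δ) - q' (μ + i * δ)) - (q μ - q' μ) := by
      intro i
      induction i with
      | zero => simp
      | succ i ih =>
        have h1 := hq (μ + i * δ) (μ + (i + 1 : ℕ) * δ)
        have h2 := hq' (μ + (i + 1 : ℕ) * δ) (μ + i * δ)
        have h3 := mul_le_mul_of_nonneg_left (hc (μ + i * δ)) hδ0
        push_cast at h1 h2 ⊢
        linarith
    have h1 := hstep (N + 1)
    have h2 : μ + ((N + 1 : ℕ) : ℝ) * δ = ν := by
      rw [hδ]; push_cast; field_simp; ring
    rw [h2] at h1
    have h3 : ((N + 1 : ℕ) : ℝ) * δ = ν - μ := by linarith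
    rw [h3] at h1
    have h4 : δ * (-K) ≤ δ * (F ν - F μ) :=
      mul_le_mul_of_nonneg_left (by linarith [hF0 ν, hFK μ]) hδ0
    have h5 : K * (ν - μ) * (1 / ((N : ℝ) + 1)) = δ * K := by rw [hδ]; ring
    linarith
  have hlim : Tendsto (fun N : ℕ => c * (ν - μ) - K * (ν - μ) * (1 / ((N : ℝ) + 1))) atTop
      (𝓝 (c * (ν - μ) - K * (ν - μ) * 0)) :=
    (tendsto_one_div_add_atTop_nhds_zero_nat.const_mul _).const_sub _
  rw [mul_zero, sub_zero] at hlim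
  exact le_of_tendsto' hlim key

end Supergradient

/-! ### Dynamic programming and the Whittle index -/

section

variable {a b β : ℝ} (ha : 0 ≤ a) (hab : a < b) (hβ0 : 0 < β) (hβ1 : β < 1)

include ha hab hβ0 hβ1

/-- General orbits are bounded only by `x + t`. A bound linear in the state makes the discounted
remainder in `cost_eq_value_of_greedy` vanish. -/
theorem abs_cost_le_mul (w h ν : ℝ) (u : ℕ → Bool) {x : ℝ} (hx : 0 ≤ x) :
    |cost a b w h β ν u x| ≤
      (|h + ν| * (1 / (1 - β)) + |w| * ∑' t : ℕ, β ^ t * (1 + (t : ℝ))) * (x + 1) := by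
  refine (abs_cost_le ha hab hβ0 hβ1 w h ν u hx).trans ?_
  have h1 : ∑' t : ℕ, β ^ t * (x + t) ≤ (∑' t : ℕ, β ^ t * (1 + (t : ℝ))) * (x + 1) := by
    rw [← tsum_mul_right]
    refine (summable_pow_mul_add hβ0 hβ1 x).tsum_le_tsum (fun t => ?_)
      ((summable_pow_mul_add hβ0 hβ1 1).mul_right _)
    rw [mul_assoc]
    refine mul_le_mul_of_nonneg_left ?_ (pow_nonneg hβ0.le t)
    nlinarith [mul_nonneg hx (Nat.cast_nonneg (α := ℝ) t)]
  have h2 : |h + ν| * (1 / (1 - β)) ≤ |h + ν| * (1 / (1 - β)) * (x + 1) := by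
    have : 0 < 1 - β := sub_pos.2 hβ1
    exact le_mul_of_one_le_right (by positivity) (by linarith)
  have h3 := mul_le_mul_of_nonneg_left h1 (abs_nonneg w)
  linarith

theorem bddBelow_cost (w h ν : ℝ) {x : ℝ} (hx : 0 ≤ x) :
    BddBelow (range fun u => cost a b w h β ν u x) :=
  ⟨_, by rintro _ ⟨u, rfl⟩; exact (abs_le.1 (abs_cost_le ha hab hβ0 hβ1 w h ν u hx)).1⟩

theorem value_le_cost (w h ν : ℝ) (u : ℕ → Bool) {x : ℝ} (hx : 0 ≤ x) :
    value a b w h β ν x ≤ cost a b w h β ν u x :=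
  ciInf_le (bddBelow_cost ha hab hβ0 hβ1 w h ν hx) u

theorem cost_consWord (w h ν : ℝ) (c : Bool) (u : ℕ → Bool) {x : ℝ} (hx : 0 ≤ x) :
    cost a b w h β ν (consWord c u) x =
      (h + ν) * actVal c + w * x + β * cost a b w h β ν u (phi a b c x) := by
  rw [cost_split ha hab hβ0 hβ1 w h ν _ hx 1]
  have : (fun t => consWord c u (1 + t)) = u := funext fun t => by rw [add_comm]; rfl
  rw [this]
  simp [traj, consWord]

theorem Q_le_cost (w h ν : ℝ) (u : ℕ → Bool) {x : ℝ} (hx : 0 ≤ x) :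
    Q a b w h β ν x (u 0) ≤ cost a b w h β ν u x := by
  rw [cost_split ha hab hβ0 hβ1 w h ν u hx 1, Q]
  have := value_le_cost ha hab hβ0 hβ1 w h ν (fun t => u (1 + t)) (phi_pos ha hab (u 0) hx).le
  simp only [Finset.sum_range_one, pow_zero, one_mul, pow_one, traj]
  exact add_le_add le_rfl (mul_le_mul_of_nonneg_left this hβ0.le)

theorem value_le_Q (w h ν : ℝ) (c : Bool) {x : ℝ} (hx : 0 ≤ x) :
    value a b w h β ν x ≤ Q a b w h β ν x c := by
  have : (value a b w h β ν x - ((h + ν) * actVal c + w * x)) / β ≤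
      value a b w h β ν (phi a b c x) := by
    refine le_ciInf fun u => ?_
    rw [div_le_iff₀ hβ0]
    have := value_le_cost ha hab hβ0 hβ1 w h ν (consWord c u) hx
    rw [cost_consWord ha hab hβ0 hβ1 w h ν c u hx] at this
    linarith
  rw [div_le_iff₀ hβ0] at this
  rw [Q]
  linarith

theorem value_eq_Q (w h ν : ℝ) {c : Bool} {x : ℝ} (hx : 0 ≤ x)
    (hc : Q a b w h β ν x c ≤ Q a b w h β ν x (!c)) :
    value a b w h β ν x = Q a b w h β ν x c := by
  refine le_antisymm (value_le_Q ha hab hβ0 hβ1 w h ν c hx) (le_ciInf fun u => ?_)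
  refine le_trans ?_ (Q_le_cost ha hab hβ0 hβ1 w h ν u hx)
  by_cases hu : u 0 = c
  · rw [hu]
  · have : u 0 = !c := by cases c <;> simpa using hu
    rw [this]; exact hc

theorem abs_value_le (w h ν : ℝ) {x : ℝ} (hx : 0 ≤ x) :
    |value a b w h β ν x| ≤
      (|h + ν| * (1 / (1 - β)) + |w| * ∑' t : ℕ, β ^ t * (1 + (t : ℝ))) * (x + 1) := by
  have hb := fun u => abs_le.1 (abs_cost_le_mul ha hab hβ0 hβ1 w h ν u hx)
  rw [abs_le]
  exact ⟨le_ciInf fun u => (hb u).1,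
    (value_le_cost ha hab hβ0 hβ1 w h ν (fun _ => false) hx).trans (hb _).2⟩

/-- A word all of whose actions are optimal in the state in which they are taken is optimal. -/
theorem cost_eq_value_of_greedy (w h ν : ℝ) {u : ℕ → Bool} {x : ℝ} (hx : 0 ≤ x)
    (hu : ∀ t, Q a b w h β ν (traj a b u x t) (u t) ≤ Q a b w h β ν (traj a b u x t) (!u t)) :
    cost a b w h β ν u x = value a b w h β ν x := by
  set E := |h + ν| * (1 / (1 - β)) + |w| * ∑' t : ℕ, β ^ t * (1 + (t : ℝ)) with hE
  have hE0 : 0 ≤ E := by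
    have := (abs_nonneg _).trans (abs_cost_le_mul ha hab hβ0 hβ1 w h ν u hx)
    exact nonneg_of_mul_nonneg_left this (by linarith)
  have hnn := traj_nonneg ha hab u hx
  have hval : ∀ N, value a b w h β ν x =
      ∑ t ∈ Finset.range N, β ^ t * ((h + ν) * actVal (u t) + w * traj a b u x t) +
        β ^ N * value a b w h β ν (traj a b u x N) := by
    intro N
    induction N with
    | zero => simp [traj]
    | succ N ih =>
      rw [ih, Finset.sum_range_succ, value_eq_Q ha hab hβ0 hβ1 w h ν (hnn N) (hu N), Q, traj,
        pow_succ]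
      ring
  have key : ∀ N : ℕ, |cost a b w h β ν u x - value a b w h β ν x| ≤
      2 * E * (β ^ N * ((x + 1) + N)) := by
    intro N
    rw [cost_split ha hab hβ0 hβ1 w h ν u hx N, hval N, add_sub_add_left_eq_sub, ← mul_sub,
      abs_mul, abs_of_nonneg (pow_nonneg hβ0.le N)]
    have h1 := abs_cost_le_mul ha hab hβ0 hβ1 w h ν (fun t => u (N + t)) (hnn N)
    have h2 := abs_value_le ha hab hβ0 hβ1 w h ν (hnn N)
    have h3 := traj_le_add ha hab u hx N
    rw [← hE] at h1 h2
    have h4 : E * (traj a b u x N + 1) ≤ E * (x + 1 + N) :=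
      mul_le_mul_of_nonneg_left (by linarith) hE0
    have h5 := (abs_sub _ _).trans ((add_le_add h1 h2).trans (add_le_add h4 h4))
    have := mul_le_mul_of_nonneg_left h5 (pow_nonneg hβ0.le N)
    linarith
  have hlim := ((summable_pow_mul_add hβ0 hβ1 (x + 1)).tendsto_atTop_zero).const_mul (2 * E)
  rw [mul_zero] at hlim
  exact sub_eq_zero.1 (abs_nonpos_iff.1 (ge_of_tendsto' hlim key))

theorem cost_eq_value_of_isOptimal (w h ν : ℝ) {u : ℕ → Bool} {x : ℝ} (hx : 0 ≤ x)
    (hu : IsOptimal a b w h β ν u x) : cost a b w h β ν u x = value a b w h β ν x :=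
  le_antisymm (le_ciInf hu) (value_le_cost ha hab hβ0 hβ1 w h ν u hx)

omit hβ0 hβ1 in
/-- Under a common threshold policy from time `1` on, starting with the action `true` leads to at
least as many activations as starting with the action `false`. -/
theorem count_consWord_le (s : EReal) {x : ℝ} (hx : 0 ≤ x) (t : ℕ) :
    count (consWord false (policyActions a b (thresholdPolicy s) (phi a b false x))) t ≤
      count (consWord true (policyActions a b (thresholdPolicy s) (phi a b true x))) t := by
  refine count_le_count_of_traj ha hab (fun t ht h => ?_) t
  rcases t with _ | t
  · rfl
  · have h1 := ht x hx
    rw [traj_consWord, traj_consWord, traj_policyActions, traj_policyActions] at h1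
    simp only [consWord, policyActions, thresholdPolicy, decide_eq_true_eq] at h ⊢
    exact h.trans (EReal.coe_le_coe_iff.2 h1)

/-- Optimality of threshold policies makes the advantage of the action `true` in each state
continuous and decreasing in the added cost, with slope bounded away from zero. -/
theorem ThresholdOptimal.continuous_and_slope {w h : ℝ} (hA : ThresholdOptimal a b w h β) {x : ℝ}
    (hx : 0 ≤ x) :
    (Continuous fun ν => Q a b w h β ν x true - Q a b w h β ν x false) ∧
    ∀ μ ν, μ ≤ ν → (1 - β) * (ν - μ) ≤ (Q a b w h β ν x true - Q a b w h β ν x false) -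
      (Q a b w h β μ x true - Q a b w h β μ x false) := by
  choose s _ hs using hA
  -- The forced action followed by the optimal threshold word attains `Q`. The cost of a fixed word
  -- is affine in the added cost with slope `usage`, so `usage` of this word is a supergradient of
  -- `Q`.
  set W : Bool → ℝ → ℕ → Bool := fun c ν =>
    consWord c (policyActions a b (thresholdPolicy (s ν)) (phi a b c x)) with hW
  have hcost : ∀ c ν, cost a b w h β ν (W c ν) x = Q a b w h β ν x c := fun c ν => by
    have hp := (phi_pos ha hab c hx).le
    rw [hW, cost_consWord ha hab hβ0 hβ1 w h ν c _ hx,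
      cost_eq_value_of_isOptimal ha hab hβ0 hβ1 w h ν hp (hs ν _ hp), Q]
  have hsup : ∀ c μ ν, Q a b w h β μ x c ≤
      Q a b w h β ν x c + (μ - ν) * usage β (W c ν) := fun c μ ν => by
    have h1 := Q_le_cost ha hab hβ0 hβ1 w h μ (W c ν) hx
    rw [cost_eq hβ0 hβ1 ha hab _ _ _ _ hx] at h1
    rw [← hcost c ν, cost_eq hβ0 hβ1 ha hab _ _ _ _ hx]
    change Q a b w h β μ x c ≤ _ at h1
    linarith
  have h0 : ∀ c ν, 0 ≤ usage β (W c ν) := fun c ν => usage_nonneg hβ0 _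
  have hK : ∀ c ν, usage β (W c ν) ≤ 1 / (1 - β) := fun c ν => usage_le hβ0 hβ1 _
  refine ⟨(continuous_of_supergradient (hsup true) (h0 true) (hK true)).sub
    (continuous_of_supergradient (hsup false) (h0 false) (hK false)), fun μ ν hμν => ?_⟩
  exact mul_sub_le_of_supergradient (hsup true) (h0 true) (hK true) (hsup false)
    (fun ν => one_sub_le_usage_sub hβ0 hβ1 (count_consWord_le ha hab (s ν) hx) rfl rfl) hμν

theorem ThresholdOptimal.indexable {w h : ℝ} (hA : ThresholdOptimal a b w h β) :
    Indexable a b w h β := by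
  intro ν' ν hν x hx
  have h1 := (hA.continuous_and_slope ha hab hβ0 hβ1 hx).2 ν' ν hν
  have h2 : 0 ≤ (1 - β) * (ν - ν') := mul_nonneg (sub_nonneg.2 hβ1.le) (sub_nonneg.2 hν)
  constructor
  · intro h c
    cases c
    · have := h false; linarith
    · exact le_rfl
  · intro h c
    cases c
    · exact le_rfl
    · have := h true; linarith

theorem ThresholdOptimal.isWhittleIndex {w h : ℝ} (hA : ThresholdOptimal a b w h β) {x : ℝ}
    (hx : 0 ≤ x) : IsWhittleIndex a b w h β x (whittleFormula a b w h β x) := by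
  set Δ : ℝ → ℝ → ℝ := fun y ν => Q a b w h β ν y true - Q a b w h β ν y false with hΔ
  have hcont : ∀ y, 0 ≤ y → Continuous (Δ y) := fun y hy =>
    (hA.continuous_and_slope ha hab hβ0 hβ1 hy).1
  have hslope : ∀ y, 0 ≤ y → ∀ μ ν, μ ≤ ν → (1 - β) * (ν - μ) ≤ Δ y ν - Δ y μ := fun y hy =>
    (hA.continuous_and_slope ha hab hβ0 hβ1 hy).2
  have hδ : 0 < 1 - β := sub_pos.2 hβ1
  have hstrict : ∀ y, 0 ≤ y → StrictMono (Δ y) := fun y hy μ ν h => by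
    have h1 := hslope y hy μ ν h.le
    have h2 := mul_pos hδ (sub_pos.2 h)
    linarith
  choose s _ hs using hA
  have hge : ∀ (ν y : ℝ), 0 ≤ y → s ν ≤ (y : EReal) → Δ y ν ≤ 0 := fun ν y hy hsy => by
    have h1 := Q_le_cost ha hab hβ0 hβ1 w h ν (policyActions a b (thresholdPolicy (s ν)) y) hy
    rw [cost_eq_value_of_isOptimal ha hab hβ0 hβ1 w h ν hy (hs ν y hy)] at h1
    have h2 : policyActions a b (thresholdPolicy (s ν)) y 0 = true := by
      exact decide_eq_true hsy
    rw [h2] at h1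
    have := value_le_Q ha hab hβ0 hβ1 w h ν false hy
    simp only [hΔ]
    linarith
  have hlt : ∀ (ν y : ℝ), 0 ≤ y → (y : EReal) < s ν → 0 ≤ Δ y ν := fun ν y hy hsy => by
    have h1 := Q_le_cost ha hab hβ0 hβ1 w h ν (policyActions a b (thresholdPolicy (s ν)) y) hy
    rw [cost_eq_value_of_isOptimal ha hab hβ0 hβ1 w h ν hy (hs ν y hy)] at h1
    have h2 : policyActions a b (thresholdPolicy (s ν)) y 0 = false := by
      exact decide_eq_false (not_le.2 hsy)
    rw [h2] at h1
    have := value_le_Q ha hab hβ0 hβ1 w h ν true hy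
    simp only [hΔ]
    linarith
  obtain ⟨ν₀, hν₀⟩ : ∃ ν, Δ x ν = 0 := by
    have hm : 0 ≤ |Δ x 0| / (1 - β) := by positivity
    have h1 := hslope x hx 0 (|Δ x 0| / (1 - β)) hm
    have h2 := hslope x hx (-(|Δ x 0| / (1 - β))) 0 (by linarith)
    have e : (1 - β) * (|Δ x 0| / (1 - β)) = |Δ x 0| := by field_simp
    rw [sub_zero, e] at h1
    rw [sub_neg_eq_add, zero_add, e] at h2
    exact mem_range_of_exists_le_of_exists_ge (hcont x hx)
      ⟨-(|Δ x 0| / (1 - β)), by linarith [le_abs_self (Δ x 0)]⟩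
      ⟨|Δ x 0| / (1 - β), by linarith [neg_abs_le (Δ x 0)]⟩
  -- For `ν < ν₀` the action `true` is strictly better in `x`, which forces `s ν ≤ x` and makes
  -- `true` optimal in every `y ≥ x`; then `ν` increases to `ν₀`. Approaching `ν₀` from the side
  -- avoids any claim about the threshold `s ν₀` itself.
  have habove : ∀ y, x ≤ y → Δ y ν₀ ≤ 0 := fun y hxy => by
    have ht : Tendsto (Δ y) (𝓝[<] ν₀) (𝓝 (Δ y ν₀)) :=
      ((hcont y (hx.trans hxy)).tendsto ν₀).mono_left nhdsWithin_le_nhds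
    refine le_of_tendsto ht ?_
    filter_upwards [self_mem_nhdsWithin] with ν hν
    refine hge ν y (hx.trans hxy) (le_trans (not_lt.1 fun h' => ?_) (EReal.coe_le_coe_iff.2 hxy))
    have := hstrict x hx hν
    linarith [hlt ν x hx h']
  have hbelow : ∀ y, 0 ≤ y → y ≤ x → 0 ≤ Δ y ν₀ := fun y hy hyx => by
    have ht : Tendsto (Δ y) (𝓝[>] ν₀) (𝓝 (Δ y ν₀)) :=
      ((hcont y hy).tendsto ν₀).mono_left nhdsWithin_le_nhds
    refine ge_of_tendsto ht ?_
    filter_upwards [self_mem_nhdsWithin] with ν hν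
    refine hlt ν y hy (lt_of_le_of_lt (EReal.coe_le_coe_iff.2 hyx) (not_le.1 fun h' => ?_))
    have := hstrict x hx hν
    linarith [hge ν x hx h']
  have hgreedy : ∀ u : ℕ → Bool, (∀ T, IsThresholdWord a b x u T) →
      cost a b w h β ν₀ u x = value a b w h β ν₀ x := fun u hu =>
    cost_eq_value_of_greedy ha hab hβ0 hβ1 w h ν₀ hx fun t => by
      have h1 := hu (t + 1) t (Nat.lt_succ_self t)
      rcases hut : u t with _ | _
      · have := hbelow _ (traj_nonneg ha hab u hx t) (h1.2 hut)
        simp only [hΔ] at this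
        simp only [Bool.not_false]
        linarith
      · have := habove _ (h1.1 hut)
        simp only [hΔ] at this
        simp only [Bool.not_true]
        linarith
  have hindex : ν₀ = whittleFormula a b w h β x :=
    (cost_action_eq_iff hβ0 hβ1 ha hab w h ν₀ hx).1 <|
      (hgreedy _ (isThresholdWord_action0 a b x)).trans
        (hgreedy _ (isThresholdWord_action1 a b x)).symm
  intro ν
  rw [← hindex, ← (hstrict x hx).injective.eq_iff (a := ν), hν₀, hΔ]
  simp only
  rw [sub_eq_zero, eq_comm]

end

end KalmanBandit

end

theorem theorem1 (a b w h β : ℝ) (ha : 0 ≤ a) (hab : a < b) (hw : 0 ≤ w)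
    (hβ0 : 0 < β) (hβ1 : β < 1) :
    ContinuousOn (KalmanBandit.whittleFormula a b w h β) (Set.Ici 0) ∧
    MonotoneOn (KalmanBandit.whittleFormula a b w h β) (Set.Ici 0) ∧
    (KalmanBandit.ThresholdOptimal a b w h β →
      KalmanBandit.Indexable a b w h β ∧
      ∀ x : ℝ, 0 ≤ x →
        KalmanBandit.IsWhittleIndex a b w h β x (KalmanBandit.whittleFormula a b w h β x)) :=
  ⟨KalmanBandit.continuousOn_whittleFormula ha hab hβ0 hβ1 w h,
    KalmanBandit.monotoneOn_whittleFormula ha hab hβ0 hβ1 hw h,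
    fun hA => ⟨hA.indexable ha hab hβ0 hβ1, fun _ hx => hA.isWhittleIndex ha hab hβ0 hβ1 hx⟩⟩
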